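/- Let $\hbar>0$ and, for $n\in\mathbf N$, let $\mathfrak H_n=L^2(\mathbf R^n,dy)$. A density matrix on $\mathfrak H_n$ is a positive (self-adjoint) bounded operator of trace $1$; a probability density on $\mathbf R^n\times\mathbf R^n$ is an a.e. nonnegative integrable function with integral $1$. For a probability density $p$ on $\mathbf R^n\times\mathbf R^n$ and a density matrix $R$ on $\mathfrak H_n$, let $\mathcal C(p,R)$ be the set of couplings of $p$ and $R$, i.e. of weakly measurable functions $Q$ from $\mathbf R^n\times\mathbf R^n$ to the bounded operators on $\mathfrak H_n$ such that, for a.e. $(x,\xi)$, $Q(x,\xi)=Q(x,\xi)^*\ge 0$ and $\operatorname{trace}Q(x,\xi)=p(x,\xi)$, and such that $\iint Q(x,\xi)\,dx\,d\xi=R$ (in the weak sense). Set $$E_\hbar(p,R)=\Big(\inf_{Q\in\mathcal C(p,R)}\iint_{\mathbf R^n\times\mathbf R^n}\operatorname{trace}\big(Q(x,\xi)^{1/2}c_\hbar(x,\xi)Q(x,\xi)^{1/2}\big)\,dx\,d\xi\Big)^{1/2}\in[0,+\infty],$$ where $c_\hbar(x,\xi)=\tfrac12\big(|x-y|^2+|\xi+i\hbar\nabla_y|^2\big)$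 is the unbounded nonnegative self-adjoint operator on $\mathfrak H_n$ with form domain $\{\varphi\in H^1(\mathbf R^n): |y|\varphi\in L^2(\mathbf R^n)\}$; the trace is $\sum_k\langle Q^{1/2}e_k|c_\hbar|Q^{1/2}e_k\rangle$ for an orthonormal basis $(e_k)$, a term being $+\infty$ when $Q^{1/2}e_k$ is not in the form domain. Let $R_1,\dots,R_N$ be density matrices on $L^2(\mathbf R^d)$ and let $f_1,\dots,f_N$ be probability densities on $\mathbf R^d\times\mathbf R^d$. Let $R=R_1\otimes\dots\otimes R_N$ on $L^2(\mathbf R^{Nd})=L^2(\mathbf R^d)^{\otimes N}$ and $$f(X,\Xi)=f_1(x_1,\xi_1)\cdots f_N(x_N,\xi_N),\qquad X=(x_1,\dots,x_N),\ \Xi=(\xi_1,\dots,\xi_N).$$ Then, in $[0,+\infty]$, $$E_\hbar(f,R)^2\le E_\hbar(f_1,R_1)^2+\dots+E_\hbar(f_N,R_N)^2.$$ -/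

import Mathlib

open MeasureTheory Complex
open scoped ENNReal ContDiff InnerProductSpace

noncomputable section

namespace SemiclassicalOT

/-! ## Spaces -/

/-- The configuration space `ℝ^κ`, with the Euclidean norm and Lebesgue measure. One particle in
dimension `d` is the case `κ = Fin d`; `N` such particles are the case `κ = Fin N × Fin d`. -/
abbrev Config (κ : Type) [Fintype κ] : Type := EuclideanSpace ℝ κ

/-- The phase space `ℝ^κ × ℝ^κ` of pairs `(x, ξ)`, with Lebesgue measure. -/
abbrev Phase (κ : Type) [Fintype κ] : Type := Config κ × Config κ

/-- The Hilbert space `L²(ℝ^κ; ℂ)`. -/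
abbrev WaveSpace (κ : Type) [Fintype κ] : Type :=
  Lp ℂ 2 (volume : Measure (EuclideanSpace ℝ κ))

/-! ## Traces and density matrices -/

section Trace

variable (H : Type) [NormedAddCommGroup H] [InnerProductSpace ℂ H] [CompleteSpace H]

/-- The index set of a fixed Hilbert basis of `H`. -/
def basisSet : Set H := (exists_hilbertBasis ℂ H).choose

/-- A fixed Hilbert basis of `H`; the traces below do not depend on it. -/
def stdBasis : HilbertBasis (basisSet H) ℂ H := (exists_hilbertBasis ℂ H).choose_spec.choose

variable {H}

/-- The trace `∑ ⟨e_k, T e_k⟩ ∈ [0, ∞]` of a positive bounded operator `T`. -/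
def posTrace (T : H →L[ℂ] H) : ℝ≥0∞ :=
  ∑' k, ENNReal.ofReal (⟪stdBasis H k, T (stdBasis H k)⟫_ℂ).re

/-- Density matrices: positive (self-adjoint) operators of trace one. -/
structure IsDensityMatrix (R : H →L[ℂ] H) : Prop where
  isPositive : R.IsPositive
  trace_eq_one : posTrace R = 1

/-- The positive square root of a positive bounded operator. -/
def opSqrt (T : H →L[ℂ] H) : H →L[ℂ] H := CFC.sqrt T

end Trace

section Single

variable {κ : Type} [Fintype κ]

/-- Probability densities on phase space. -/
structure IsProbabilityDensity (p : Phase κ → ℝ) : Prop where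
  nonneg : ∀ᵐ z, 0 ≤ p z
  integrable : Integrable p
  integral_eq_one : ∫ z, p z = 1

/-! ## Couplings -/

/-- Couplings of a classical density `p` and a density matrix `R`: weakly measurable functions
`z ↦ Q z` whose values are a.e. positive operators of trace `p z`, and with `∫ Q = R`. The
integral is meant weakly; its matrix elements converge absolutely as
`|⟨φ, Q z ψ⟩| ≤ ‖φ‖ ‖ψ‖ p z`. -/
structure IsCoupling (p : Phase κ → ℝ) (R : WaveSpace κ →L[ℂ] WaveSpace κ)
    (Q : Phase κ → (WaveSpace κ →L[ℂ] WaveSpace κ)) : Prop where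
  aemeasurable : ∀ φ ψ : WaveSpace κ, AEMeasurable fun z => ⟪φ, Q z ψ⟫_ℂ
  isPositive : ∀ᵐ z, (Q z).IsPositive
  trace_eq : ∀ᵐ z, posTrace (Q z) = ENNReal.ofReal (p z)
  integral_eq : ∀ φ ψ : WaveSpace κ, ∫ z, ⟪φ, Q z ψ⟫_ℂ = ⟪φ, R ψ⟫_ℂ

/-! ## The cost operator -/

/-- `g = ∂_j φ` in the sense of distributions, for `φ, g ∈ L²`. -/
def IsWeakDeriv [DecidableEq κ] (j : κ) (φ g : WaveSpace κ) : Prop :=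
  ∀ χ : Config κ → ℝ, ContDiff ℝ ∞ χ → HasCompactSupport χ →
    ∫ y, (fderiv ℝ χ y (EuclideanSpace.single j 1)) • φ y = - ∫ y, χ y • g y

/-- `‖(x_j - y_j) φ‖²` in `[0, ∞]`. -/
def positionCost (x : Config κ) (j : κ) (φ : WaveSpace κ) : ℝ≥0∞ :=
  ∫⁻ y, ‖(x j - y j) • φ y‖ₑ ^ 2

/-- `‖(ξ_j + iħ ∂_j) φ‖²` if `φ` has a weak derivative `∂_j φ` in `L²` (it is then unique),
and `∞` otherwise. -/
def momentumCost [DecidableEq κ] (ħ : ℝ) (ξ : Config κ) (j : κ) (φ : WaveSpace κ) : ℝ≥0∞ :=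
  ⨅ (g : WaveSpace κ) (_ : IsWeakDeriv j φ g), ‖(ξ j : ℂ) • φ + (I * (ħ : ℂ)) • g‖ₑ ^ 2

/-- The closed quadratic form `φ ↦ ⟨φ, c(x, ξ) φ⟩ ∈ [0, ∞]` of the unbounded self-adjoint operator
`c(x, ξ) = ½ (|x - y|² + |ξ + iħ∇_y|²) ≥ 0` on `L²(ℝ^κ, dy)`. It is finite exactly on the form
domain `{φ ∈ H¹ : |y| φ ∈ L²}` (for `ħ ≠ 0`). -/
def costForm [DecidableEq κ] (ħ : ℝ) (z : Phase κ) (φ : WaveSpace κ) : ℝ≥0∞ :=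
  2⁻¹ * ∑ j, (positionCost z.1 j φ + momentumCost ħ z.2 j φ)

/-- `trace (c(z) T) = trace (T^{1/2} c(z) T^{1/2}) ∈ [0, ∞]` for a positive operator `T`. -/
def costTrace [DecidableEq κ] (ħ : ℝ) (z : Phase κ) (T : WaveSpace κ →L[ℂ] WaveSpace κ) : ℝ≥0∞ :=
  ∑' k, costForm ħ z (opSqrt T (stdBasis (WaveSpace κ) k))

/-- The pseudo-distance
`E_ħ(p, R) = (inf_{Q ∈ C(p, R)} ∫ trace (c(x, ξ) Q(x, ξ)) dx dξ)^{1/2} ∈ [0, ∞]`. -/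
def pseudoDist [DecidableEq κ] (ħ : ℝ) (p : Phase κ → ℝ) (R : WaveSpace κ →L[ℂ] WaveSpace κ) :
    ℝ≥0∞ :=
  (⨅ (Q : Phase κ → (WaveSpace κ →L[ℂ] WaveSpace κ)) (_ : IsCoupling p R Q),
    ∫⁻ z, costTrace ħ z (Q z)) ^ (1 / 2 : ℝ)

end Single

/-! ## Tensor products -/

section Tensor

variable {ι κ : Type} [Fintype ι] [Fintype κ]

/-- The coordinates `y_i ∈ ℝ^κ` of the `i`-th particle in a configuration `y ∈ (ℝ^κ)^ι`. -/
def part (i : ι) (y : Config (ι × κ)) : Config κ := WithLp.toLp 2 fun k => y (i, k)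

/-- The tensor product `(X, Ξ) ↦ ∏ i, f_i(x_i, ξ_i)` of functions on phase space. -/
def tensorDensity (f : ι → Phase κ → ℝ) : Phase (ι × κ) → ℝ :=
  fun z => ∏ i, f i (part i z.1, part i z.2)

theorem measurePreserving_part :
    MeasurePreserving (fun (y : Config (ι × κ)) (i : ι) => part i y) := by
  have h1 : MeasurePreserving (MeasurableEquiv.curry ι κ ℝ) := by
    refine MeasurePreserving.symm (MeasurableEquiv.curry ι κ ℝ).symm ⟨by fun_prop, ?_⟩
    refine (Measure.pi_eq fun s hs => ?_).symm
    rw [MeasurableEquiv.map_apply]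
    have : (MeasurableEquiv.curry ι κ ℝ).symm ⁻¹' (Set.univ.pi s)
        = Set.univ.pi fun i => Set.univ.pi fun k => s (i, k) := by
      ext g
      simp [Set.mem_pi, MeasurableEquiv.coe_curry_symm, Function.uncurry]
    rw [this, volume_pi_pi]
    simp_rw [volume_pi_pi]
    rw [Fintype.prod_prod_type]
  exact ((volume_preserving_pi fun _ : ι => PiLp.volume_preserving_toLp κ).comp h1).comp
    (PiLp.volume_preserving_ofLp (ι × κ))

theorem quasiMeasurePreserving_part (i : ι) :
    Measure.QuasiMeasurePreserving (part i : Config (ι × κ) → Config κ) :=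
  (Measure.quasiMeasurePreserving_eval (fun _ : ι => (volume : Measure (Config κ))) i).comp
    measurePreserving_part.quasiMeasurePreserving

theorem memLp_tensor (φ : ι → WaveSpace κ) :
    MemLp (fun y : Config (ι × κ) => ∏ i, φ i (part i y)) 2 volume := by
  have hm : AEStronglyMeasurable (fun y : Config (ι × κ) => ∏ i, φ i (part i y)) volume := by
    refine Finset.aestronglyMeasurable_fun_prod _ fun i _ => ?_
    exact (Lp.aestronglyMeasurable (φ i)).comp_quasiMeasurePreserving
      (quasiMeasurePreserving_part i)
  rw [memLp_two_iff_integrable_sq_norm hm]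
  simp_rw [norm_prod, ← Finset.prod_pow]
  have h := Integrable.fintype_prod (μ := fun _ : ι => (volume : Measure (Config κ)))
    (f := fun i x => ‖φ i x‖ ^ 2)
    fun i => (memLp_two_iff_integrable_sq_norm (Lp.aestronglyMeasurable (φ i))).1 (Lp.memLp (φ i))
  exact measurePreserving_part.integrable_comp_of_integrable h

/-- The tensor product `φ_1 ⊗ … ⊗ φ_N`, i.e. the function `y ↦ ∏ i, φ_i(y_i)`. -/
def tensorVec (φ : ι → WaveSpace κ) : WaveSpace (ι × κ) := (memLp_tensor φ).toLp _

theorem coeFn_tensorVec (φ : ι → WaveSpace κ) :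
    tensorVec φ =ᵐ[volume] fun y => ∏ i, φ i (part i y) := (memLp_tensor φ).coeFn_toLp

theorem inner_tensorVec (φ ψ : ι → WaveSpace κ) :
    ⟪tensorVec φ, tensorVec ψ⟫_ℂ = ∏ i, ⟪φ i, ψ i⟫_ℂ := by
  have h : ⟪tensorVec φ, tensorVec ψ⟫_ℂ
      = ∫ y : Config (ι × κ), ∏ i, ⟪φ i (part i y), ψ i (part i y)⟫_ℂ := by
    rw [L2.inner_def]
    refine integral_congr_ae ?_
    filter_upwards [coeFn_tensorVec φ, coeFn_tensorVec ψ] with y h1 h2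
    rw [h1, h2]
    simp [Finset.prod_mul_distrib]
  simp_rw [h, L2.inner_def]
  rw [← integral_fintype_prod_volume_eq_prod
    (fun (i : ι) (x : Config κ) => ⟪φ i x, ψ i x⟫_ℂ), ← measurePreserving_part.map_eq,
    integral_map measurePreserving_part.measurable.aemeasurable]
  rw [measurePreserving_part.map_eq]
  exact (Integrable.fintype_prod (μ := fun _ : ι => (volume : Measure (Config κ)))
    fun i => L2.integrable_inner (𝕜 := ℂ) (φ i) (ψ i)).aestronglyMeasurable

theorem tensorVec_update_add [DecidableEq ι] (φ : ι → WaveSpace κ) (i : ι) (a b : WaveSpace κ) :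
    tensorVec (Function.update φ i (a + b))
      = tensorVec (Function.update φ i a) + tensorVec (Function.update φ i b) := by
  refine Lp.ext ?_
  filter_upwards [coeFn_tensorVec (Function.update φ i (a + b)),
    coeFn_tensorVec (Function.update φ i a), coeFn_tensorVec (Function.update φ i b),
    Lp.coeFn_add (tensorVec (Function.update φ i a)) (tensorVec (Function.update φ i b)),
    (quasiMeasurePreserving_part i).ae (Lp.coeFn_add a b)] with y h1 h2 h3 h4 h5
  rw [h4, Pi.add_apply, h1, h2, h3]
  simp only [← Finset.mul_prod_erase _ _ (Finset.mem_univ i), Function.update_self, h5,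
    Pi.add_apply, add_mul]
  congr 2 <;> exact Finset.prod_congr rfl fun j hj => by
    rw [Function.update_of_ne (Finset.ne_of_mem_erase hj),
      Function.update_of_ne (Finset.ne_of_mem_erase hj)]

theorem tensorVec_update_smul [DecidableEq ι] (φ : ι → WaveSpace κ) (i : ι) (c : ℂ)
    (a : WaveSpace κ) :
    tensorVec (Function.update φ i (c • a)) = c • tensorVec (Function.update φ i a) := by
  refine Lp.ext ?_
  filter_upwards [coeFn_tensorVec (Function.update φ i (c • a)),
    coeFn_tensorVec (Function.update φ i a), Lp.coeFn_smul c (tensorVec (Function.update φ i a)),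
    (quasiMeasurePreserving_part i).ae (Lp.coeFn_smul c a)] with y h1 h2 h3 h4
  rw [h3, Pi.smul_apply, h1, h2]
  simp only [← Finset.mul_prod_erase _ _ (Finset.mem_univ i), Function.update_self, h4,
    Pi.smul_apply, smul_eq_mul, mul_assoc]
  congr 2
  exact Finset.prod_congr rfl fun j hj => by
    rw [Function.update_of_ne (Finset.ne_of_mem_erase hj),
      Function.update_of_ne (Finset.ne_of_mem_erase hj)]

/-- Two families of vectors with the same Gram matrix are related by a bounded operator. -/
theorem exists_clm_of_inner_eq {H α : Type} [NormedAddCommGroup H] [InnerProductSpace ℂ H]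
    [CompleteSpace H] (v w : α → H) (h : ∀ a b, ⟪w a, w b⟫_ℂ = ⟪v a, v b⟫_ℂ) :
    ∃ T : H →L[ℂ] H, ∀ a, T (v a) = w a := by
  classical
  let V : (α →₀ ℂ) →ₗ[ℂ] H := Finsupp.linearCombination ℂ v
  let W : (α →₀ ℂ) →ₗ[ℂ] H := Finsupp.linearCombination ℂ w
  have hVW : ∀ x, ‖W x‖ = ‖V x‖ := by
    intro x
    have : ⟪W x, W x⟫_ℂ = ⟪V x, V x⟫_ℂ := by
      simp only [V, W, Finsupp.linearCombination_apply, Finsupp.sum, sum_inner, inner_sum,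
        inner_smul_left, inner_smul_right, h]
    rw [@norm_eq_sqrt_re_inner ℂ, @norm_eq_sqrt_re_inner ℂ, this]
  let K : Submodule ℂ H := (LinearMap.range V).topologicalClosure
  have hK : ∀ x, V x ∈ K := fun x => (LinearMap.range V).le_topologicalClosure ⟨x, rfl⟩
  let e : (α →₀ ℂ) →ₗ[ℂ] K := V.codRestrict K hK
  have hd : DenseRange e := by
    rintro ⟨x, hx⟩
    rw [closure_subtype]
    have : Subtype.val '' Set.range e = Set.range V := by
      ext y; simp [e, ← Set.range_comp]
    rw [this]
    exact hx
  have : CompleteSpace K := (LinearMap.range V).isClosed_topologicalClosure.completeSpace_coe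
  refine ⟨(W.extendOfNorm e).comp K.orthogonalProjectionOnto, fun a => ?_⟩
  have h1 : v a = V (Finsupp.single a 1) := by simp [V]
  have h2 : K.orthogonalProjectionOnto (v a) = e (Finsupp.single a 1) := by
    rw [h1]
    exact Submodule.orthogonalProjectionOnto_mem_subspace_eq_self (e (Finsupp.single a 1))
  rw [ContinuousLinearMap.comp_apply, h2,
    LinearMap.extendOfNorm_eq hd ⟨1, fun x => by rw [one_mul, hVW x]; rfl⟩]
  simp [W]

/-- The operator acting as `T` on the `i`-th factor and trivially on the others. -/
theorem exists_tensor_single [DecidableEq ι] (i : ι) (T : WaveSpace κ →L[ℂ] WaveSpace κ) :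
    ∃ S : WaveSpace (ι × κ) →L[ℂ] WaveSpace (ι × κ),
      ∀ φ : ι → WaveSpace κ, S (tensorVec φ) = tensorVec (Function.update φ i (T (φ i))) := by
  have hT : T ∈ Submodule.span ℂ (unitary (WaveSpace κ →L[ℂ] WaveSpace κ) : Set _) := by
    rw [CStarAlgebra.span_unitary]; trivial
  induction hT using Submodule.span_induction with
  | mem U hU =>
    refine exists_clm_of_inner_eq _ _ fun φ ψ => ?_
    simp only [inner_tensorVec]
    refine Finset.prod_congr rfl fun j _ => ?_
    by_cases hj : j = i
    · subst hj
      have h1 : star U * U = 1 := (Unitary.mem_iff.1 hU).1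
      rw [Function.update_self, Function.update_self, ← ContinuousLinearMap.adjoint_inner_right,
        ← ContinuousLinearMap.star_eq_adjoint, ← ContinuousLinearMap.comp_apply,
        ← ContinuousLinearMap.mul_def, h1]
      simp
    · simp [Function.update_of_ne hj]
  | zero =>
    refine ⟨0, fun φ => ?_⟩
    have := tensorVec_update_smul φ i 0 0
    simpa using this.symm
  | add A B _ _ hA hB =>
    obtain ⟨S, hS⟩ := hA
    obtain ⟨S', hS'⟩ := hB
    refine ⟨S + S', fun φ => ?_⟩
    simp [hS, hS', tensorVec_update_add]
  | smul c A _ hA =>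
    obtain ⟨S, hS⟩ := hA
    refine ⟨c • S, fun φ => ?_⟩
    simp [hS, tensorVec_update_smul]

theorem exists_tensorOp (R : ι → WaveSpace κ →L[ℂ] WaveSpace κ) :
    ∃ S : WaveSpace (ι × κ) →L[ℂ] WaveSpace (ι × κ),
      ∀ φ : ι → WaveSpace κ, S (tensorVec φ) = tensorVec fun i => R i (φ i) := by
  classical
  have key : ∀ s : Finset ι, ∃ S : WaveSpace (ι × κ) →L[ℂ] WaveSpace (ι × κ),
      ∀ φ : ι → WaveSpace κ,
        S (tensorVec φ) = tensorVec fun i => if i ∈ s then R i (φ i) else φ i := by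
    intro s
    induction s using Finset.induction_on with
    | empty => exact ⟨ContinuousLinearMap.id ℂ _, fun φ => by simp⟩
    | insert a s ha ih =>
      obtain ⟨S, hS⟩ := ih
      obtain ⟨S', hS'⟩ := exists_tensor_single (κ := κ) a (R a)
      refine ⟨S'.comp S, fun φ => ?_⟩
      rw [ContinuousLinearMap.comp_apply, hS, hS']
      congr 1
      funext i
      by_cases hi : i = a
      · subst hi; simp [ha]
      · simp [hi]
  obtain ⟨S, hS⟩ := key Finset.univ
  exact ⟨S, fun φ => by simpa using hS φ⟩

/-- The tensor product `R_1 ⊗ … ⊗ R_N`: the bounded operator on `L²((ℝ^κ)^ι)` that maps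
`φ_1 ⊗ … ⊗ φ_N` to `R_1 φ_1 ⊗ … ⊗ R_N φ_N` (unique, as these vectors span a dense subspace). -/
def tensorOp (R : ι → WaveSpace κ →L[ℂ] WaveSpace κ) :
    WaveSpace (ι × κ) →L[ℂ] WaveSpace (ι × κ) :=
  (exists_tensorOp R).choose

theorem tensorOp_tensorVec (R : ι → WaveSpace κ →L[ℂ] WaveSpace κ) (φ : ι → WaveSpace κ) :
    tensorOp R (tensorVec φ) = tensorVec fun i => R i (φ i) :=
  (exists_tensorOp R).choose_spec φ

end Tensor

end SemiclassicalOT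

end

open SemiclassicalOT

noncomputable section

namespace SemiclassicalOT

/-! ## Traces of square roots -/

section Hilbert

variable {H : Type} [NormedAddCommGroup H] [InnerProductSpace ℂ H]

/-! Choose a coupling `Q i` of `f i` and `R i` for each particle. The pointwise tensor product
`tensorCoupling Q` is a coupling of the product density and the product operator
(`isCoupling_tensorCoupling`). The `N`-particle cost is the sum of the one-particle costs, the
`i`-th acting on the `i`-th factor alone. The trace therefore splits into `N` terms, the `i`-th
being the cost trace of factor `i` times the traces of the others (`costTrace_tensorOp_le`). Those
traces are densities of integral one, so Tonelli leaves the sum of the one-particle costs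
(`lintegral_costTrace_tensorCoupling_le`). The `Q i` are chosen independently, so the right side may
be minimised term by term (`sum_iInf_le_of_forall`).

The difficulty is that the cost is unbounded while couplings are only weakly measurable.
`exists_costForm_eq_tsum` writes the form as a countable sum of terms `|⟨w_l(z), φ⟩|²` with `w_l`
affine in the coordinates of `z`. The cost trace of a positive `T` is then `½ ∑ ⟨w_l, T w_l⟩`. It
depends on neither the basis nor the square root, so product bases and products of square roots may
be used (`costTrace_eq_tsum_basis`), and it is a measurable function of `z`, as Tonelli requires
(`aemeasurable_costTrace`). -/

theorem enorm_sq_eq_ofReal {E : Type} [NormedAddCommGroup E] (x : E) : ‖x‖ₑ ^ 2 = ENNReal.ofReal (‖x‖ ^ 2) := by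
  rw [← ofReal_norm, ENNReal.ofReal_pow (norm_nonneg _)]

theorem tsum_enorm_sq_inner {ι : Type} (b : HilbertBasis ι ℂ H) (x : H) :
    ∑' i, ‖⟪b i, x⟫_ℂ‖ₑ ^ 2 = ‖x‖ₑ ^ 2 := by
  have h := (Complex.hasSum_re (b.hasSum_inner_mul_inner x x))
  have h2 : ∀ i, (⟪x, b i⟫_ℂ * ⟪b i, x⟫_ℂ).re = ‖⟪b i, x⟫_ℂ‖ ^ 2 := fun i => by
    rw [← inner_conj_symm, ← Complex.normSq_eq_conj_mul_self, Complex.ofReal_re,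
      Complex.normSq_eq_norm_sq]
  simp_rw [h2] at h
  have h3 : (⟪x, x⟫_ℂ).re = ‖x‖ ^ 2 := inner_self_eq_norm_sq (𝕜 := ℂ) x
  rw [h3] at h
  have h4 : ∀ i, ‖⟪b i, x⟫_ℂ‖ₑ ^ 2 = ENNReal.ofReal (‖⟪b i, x⟫_ℂ‖ ^ 2) := fun i =>
    enorm_sq_eq_ofReal _
  simp_rw [h4]
  rw [← ENNReal.ofReal_tsum_of_nonneg (fun _ => by positivity) h.summable, h.tsum_eq,
    enorm_sq_eq_ofReal]

theorem enorm_inner_symm (x y : H) : ‖⟪x, y⟫_ℂ‖ₑ = ‖⟪y, x⟫_ℂ‖ₑ := by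
  rw [← ofReal_norm, ← ofReal_norm, norm_inner_symm]

theorem inner_apply_symm [CompleteSpace H] {S : H →L[ℂ] H} (hS : IsSelfAdjoint S) (x y : H) :
    ⟪S x, y⟫_ℂ = ⟪x, S y⟫_ℂ := hS.isSymmetric x y

/-- Both sides are the double sum of `|⟨b' j, S (b i)⟩|²`, which is symmetric in the two bases
because `S` is self-adjoint. -/
theorem tsum_enorm_sq_apply [CompleteSpace H] {S : H →L[ℂ] H} (hS : IsSelfAdjoint S)
    {ι ι' : Type} (b : HilbertBasis ι ℂ H) (b' : HilbertBasis ι' ℂ H) :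
    ∑' i, ‖S (b i)‖ₑ ^ 2 = ∑' i, ‖S (b' i)‖ₑ ^ 2 := by
  simp_rw [fun i => (tsum_enorm_sq_inner b' (S (b i))).symm]
  rw [ENNReal.tsum_comm]
  refine tsum_congr fun j => ?_
  rw [← tsum_enorm_sq_inner b]
  refine tsum_congr fun i => ?_
  rw [enorm_inner_symm, inner_apply_symm hS]

theorem inner_sq_apply [CompleteSpace H] {S T : H →L[ℂ] H} (hS : IsSelfAdjoint S) (hT : S * S = T)
    (x y : H) : ⟪x, T y⟫_ℂ = ⟪S x, S y⟫_ℂ := by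
  rw [← hT, inner_apply_symm hS]; rfl

theorem enorm_sq_sqrt [CompleteSpace H] {S T : H →L[ℂ] H} (hS : IsSelfAdjoint S) (hT : S * S = T)
    (x : H) : ‖S x‖ₑ ^ 2 = ENNReal.ofReal (⟪x, T x⟫_ℂ).re := by
  rw [inner_sq_apply hS hT, enorm_sq_eq_ofReal, ← inner_self_eq_norm_sq (𝕜 := ℂ)]
  rfl

/-- Any self-adjoint square root is allowed. A tensor product of square roots can thus be used
without being identified with `opSqrt` of the tensor product. -/
theorem posTrace_eq_tsum [CompleteSpace H] {S T : H →L[ℂ] H} (hS : IsSelfAdjoint S)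
    (hT : S * S = T) {ι : Type} (b : HilbertBasis ι ℂ H) :
    posTrace T = ∑' i, ‖S (b i)‖ₑ ^ 2 := by
  rw [← tsum_enorm_sq_apply hS (stdBasis H) b]
  simp_rw [enorm_sq_sqrt hS hT]
  rfl

theorem isSelfAdjoint_opSqrt [CompleteSpace H] (T : H →L[ℂ] H) : IsSelfAdjoint (opSqrt T) :=
  IsSelfAdjoint.of_nonneg (CFC.sqrt_nonneg T)

theorem opSqrt_mul_self [CompleteSpace H] {T : H →L[ℂ] H} (hT : T.IsPositive) :
    opSqrt T * opSqrt T = T :=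
  CFC.sqrt_mul_sqrt_self T ((ContinuousLinearMap.nonneg_iff_isPositive T).2 hT)

theorem isPositive_of_sqrt [CompleteSpace H] {S T : H →L[ℂ] H} (hS : IsSelfAdjoint S)
    (hT : S * S = T) : T.IsPositive := by
  rw [← ContinuousLinearMap.nonneg_iff_isPositive, ← hT]
  exact hS.mul_self_nonneg

/-- The operator norm is at most the Hilbert–Schmidt norm: expand `S x` in a basis, move `S` across
and apply Cauchy–Schwarz to each coefficient. -/
theorem enorm_sq_sqrt_le [CompleteSpace H] {S T : H →L[ℂ] H} (hS : IsSelfAdjoint S)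
    (hT : S * S = T) (x : H) : ‖S x‖ₑ ^ 2 ≤ posTrace T * ‖x‖ₑ ^ 2 := by
  rw [posTrace_eq_tsum hS hT (stdBasis H), ← ENNReal.tsum_mul_right,
    ← tsum_enorm_sq_inner (stdBasis H)]
  refine ENNReal.tsum_le_tsum fun i => ?_
  rw [← inner_apply_symm hS, ← mul_pow]
  gcongr
  rw [← ofReal_norm, ← ofReal_norm, ← ofReal_norm,
    ← ENNReal.ofReal_mul (norm_nonneg _)]
  exact ENNReal.ofReal_le_ofReal (norm_inner_le_norm _ _)

/-- This is the domination that makes the matrix elements of a coupling integrable. -/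
theorem norm_inner_apply_le_of_posTrace [CompleteSpace H] {T : H →L[ℂ] H} (hT : T.IsPositive)
    {p : ℝ} (hp : 0 ≤ p) (h : posTrace T = ENNReal.ofReal p) (x y : H) :
    ‖⟪x, T y⟫_ℂ‖ ≤ ‖x‖ * ‖y‖ * p := by
  have key : ∀ u, ‖opSqrt T u‖ ≤ Real.sqrt p * ‖u‖ := fun u => by
    have := enorm_sq_sqrt_le (isSelfAdjoint_opSqrt T) (opSqrt_mul_self hT) u
    rw [h, enorm_sq_eq_ofReal, enorm_sq_eq_ofReal, ← ENNReal.ofReal_mul hp,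
      ENNReal.ofReal_le_ofReal_iff (by positivity)] at this
    refine le_of_sq_le_sq ?_ (by positivity)
    rwa [mul_pow, Real.sq_sqrt hp]
  rw [inner_sq_apply (isSelfAdjoint_opSqrt T) (opSqrt_mul_self hT)]
  calc _ ≤ ‖opSqrt T x‖ * ‖opSqrt T y‖ := norm_inner_le_norm _ _
    _ ≤ (Real.sqrt p * ‖x‖) * (Real.sqrt p * ‖y‖) := by gcongr <;> exact key _
    _ = ‖x‖ * ‖y‖ * (Real.sqrt p * Real.sqrt p) := by ring
    _ = _ := by rw [Real.mul_self_sqrt hp]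

/-! ## Quadratic forms of operators defined by duality -/

/-- A Hilbert basis of vectors of the form `J v` with `v` a finite combination of indices, such
that the indices in a dense sequence (for the topology induced by `F`) are all reached. -/
theorem exists_core_basis [CompleteSpace H] {α G : Type} [Nonempty α] [TopologicalSpace G]
    [SecondCountableTopology G] (τ : α → H) (F : α → G) (P : G → H) (hP : Continuous P)
    (hF : ∀ a, P (F a) = τ a) (hτ : ∀ g : H, (∀ a, ⟪τ a, g⟫_ℂ = 0) → g = 0) :
    ∃ (M : Set ℕ) (h : HilbertBasis M ℂ H) (v : M → α →₀ ℂ) (s : ℕ → α),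
      (∀ m, Finsupp.linearCombination ℂ τ (v m) = h m) ∧
      (∀ a, F a ∈ closure (Set.range (F ∘ s))) ∧
      ∀ n, τ (s n) ∈ Submodule.span ℂ (Set.range h) := by
  obtain ⟨s, hs⟩ : ∃ s : ℕ → α, ∀ a, F a ∈ closure (Set.range (F ∘ s)) := by
    have : Nonempty (Set.range F) := (Set.range_nonempty F).to_subtype
    let u := TopologicalSpace.denseSeq (Set.range F)
    choose s hs using fun n => (u n).2
    refine ⟨s, fun a => ?_⟩
    have h1 := TopologicalSpace.denseRange_denseSeq (Set.range F) ⟨F a, a, rfl⟩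
    have h2 := image_closure_subset_closure_image continuous_subtype_val
      (Set.mem_image_of_mem Subtype.val h1)
    have h3 : Subtype.val '' Set.range (TopologicalSpace.denseSeq (Set.range F))
        = Set.range (F ∘ s) := by
      rw [← Set.range_comp]
      congr 1
      funext n
      exact (hs n).symm
    rwa [h3] at h2
  let f : ℕ → H := τ ∘ s
  -- Gram–Schmidt returns zero at each vector dependent on its predecessors; `M` discards these
  -- indices.
  let M : Set ℕ := {n | InnerProductSpace.gramSchmidtNormed ℂ f n ≠ 0}
  let w : M → H := fun m => InnerProductSpace.gramSchmidtNormed ℂ f m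
  have hw : Orthonormal ℂ w := InnerProductSpace.gramSchmidtNormed_orthonormal' f
  have hspan : Submodule.span ℂ (Set.range w) = Submodule.span ℂ (Set.range f) := by
    rw [← InnerProductSpace.span_gramSchmidt ℂ f,
      ← InnerProductSpace.span_gramSchmidtNormed_range f]
    refine le_antisymm (Submodule.span_mono ?_) (Submodule.span_le.2 ?_)
    · rintro _ ⟨m, rfl⟩
      exact ⟨m, rfl⟩
    · rintro _ ⟨n, rfl⟩
      by_cases hn : InnerProductSpace.gramSchmidtNormed ℂ f n = 0
      · rw [hn]; exact Submodule.zero_mem _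
      · exact Submodule.subset_span ⟨⟨n, hn⟩, rfl⟩
  have hd : (Submodule.span ℂ (Set.range w))ᗮ = ⊥ := by
    rw [hspan, Submodule.eq_bot_iff]
    intro g hg
    refine hτ g fun a => ?_
    -- Orthogonality to the vectors `τ (s n)` passes to every `τ a` by density in `G`.
    have hc : IsClosed {x : G | ⟪P x, g⟫_ℂ = 0} :=
      isClosed_eq (by fun_prop) continuous_const
    have : F a ∈ {x : G | ⟪P x, g⟫_ℂ = 0} := by
      refine hc.closure_subset_iff.2 ?_ (hs a)
      rintro _ ⟨n, rfl⟩
      simp only [Function.comp, Set.mem_ofPred_eq, hF]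
      exact (Submodule.mem_orthogonal _ _).1 hg _ (Submodule.subset_span ⟨n, rfl⟩)
    simpa [hF] using this
  let h : HilbertBasis M ℂ H := HilbertBasis.mkOfOrthogonalEqBot hw hd
  have hh : ⇑h = w := HilbertBasis.coe_mkOfOrthogonalEqBot hw hd
  have hv : ∀ m, ∃ v : α →₀ ℂ, Finsupp.linearCombination ℂ τ v = h m := by
    intro m
    have h1 : h m ∈ Submodule.span ℂ (Set.range τ) := by
      refine Submodule.span_mono (Set.range_comp_subset_range s τ) ?_
      change h m ∈ Submodule.span ℂ (Set.range f)
      rw [← hspan, hh]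
      exact Submodule.subset_span ⟨m, rfl⟩
    exact (Finsupp.mem_span_range_iff_exists_finsupp).1 h1
  choose v hv using hv
  refine ⟨M, h, v, s, hv, hs, fun n => ?_⟩
  rw [hh, hspan]
  exact Submodule.subset_span ⟨n, rfl⟩

/-- The square norm of the operator dual to the symmetric `β`, expanded in a core basis. -/
theorem iInf_enorm_sq_eq_tsum [CompleteSpace H] {α G M : Type} [TopologicalSpace G]
    {τ β : α → H} {F : α → G} {P B : G → H} (hP : Continuous P) (hB : Continuous B)
    (hPF : ∀ a, P (F a) = τ a) (hBF : ∀ a, B (F a) = β a)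
    (hτ : ∀ g : H, (∀ a, ⟪τ a, g⟫_ℂ = 0) → g = 0)
    (hsymm : ∀ a b, ⟪β a, τ b⟫_ℂ = ⟪τ a, β b⟫_ℂ)
    {h : HilbertBasis M ℂ H} {v : M → α →₀ ℂ} {s : ℕ → α}
    (hv : ∀ m, Finsupp.linearCombination ℂ τ (v m) = h m)
    (hs : ∀ a, F a ∈ closure (Set.range (F ∘ s)))
    (hspan : ∀ n, τ (s n) ∈ Submodule.span ℂ (Set.range h)) (φ : H) :
    ⨅ (g : H) (_ : ∀ a, ⟪β a, φ⟫_ℂ = ⟪τ a, g⟫_ℂ), ‖g‖ₑ ^ 2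
      = ∑' m, ‖⟪Finsupp.linearCombination ℂ β (v m), φ⟫_ℂ‖ₑ ^ 2 := by
  set J := Finsupp.linearCombination ℂ τ with hJ
  set D := Finsupp.linearCombination ℂ β with hD
  have hDJ : ∀ (x y : α →₀ ℂ), ⟪D x, J y⟫_ℂ = ⟪J x, D y⟫_ℂ := fun x y => by
    simp only [hJ, hD, Finsupp.linearCombination_apply, Finsupp.sum, sum_inner, inner_sum,
      inner_smul_left, inner_smul_right, hsymm]
  -- `D` factors through `J`: if `J x = 0`, symmetry makes `D x` orthogonal to the total family `τ`.
  have hker : ∀ x, J x = 0 → D x = 0 := fun x hx => by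
    refine hτ _ fun a => ?_
    rw [← inner_conj_symm]
    have h2 := hDJ x (Finsupp.single a 1)
    rw [hx, inner_zero_left] at h2
    have h3 : J (Finsupp.single a 1) = τ a := by simp [hJ]
    rw [← h3, h2, map_zero]
  -- Duality tested on the basis extends linearly to its span, which contains each `τ (s n)`, and
  -- then to every index because the sequence is dense for the topology in which `P` and `B` are
  -- both continuous.
  have hext : ∀ g : H, (∀ m, ⟪D (v m), φ⟫_ℂ = ⟪J (v m), g⟫_ℂ) →
      ∀ a, ⟪β a, φ⟫_ℂ = ⟪τ a, g⟫_ℂ := by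
    intro g hg a
    have hc : IsClosed {x : G | ⟪B x, φ⟫_ℂ = ⟪P x, g⟫_ℂ} :=
      isClosed_eq (by fun_prop) (by fun_prop)
    have : F a ∈ {x : G | ⟪B x, φ⟫_ℂ = ⟪P x, g⟫_ℂ} := by
      refine hc.closure_subset_iff.2 ?_ (hs a)
      rintro _ ⟨n, rfl⟩
      simp only [Function.comp, Set.mem_ofPred_eq, hPF, hBF]
      have h1 : τ (s n) ∈ (Submodule.span ℂ (Set.range v)).map J := by
        rw [Submodule.map_span, ← Set.range_comp]
        have : (J ∘ v) = h := funext hv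
        rw [this]; exact hspan n
      obtain ⟨x, hx, hxn⟩ := h1
      have h2 : D x = β (s n) := by
        have := hker (x - Finsupp.single (s n) 1) (by rw [map_sub, hxn]; simp [hJ])
        rw [map_sub, sub_eq_zero] at this
        rw [this]; simp [hD]
      rw [← hxn, ← h2]
      clear hxn h2
      induction hx using Submodule.span_induction with
      | mem x hx => obtain ⟨m, rfl⟩ := hx; exact hg m
      | zero => simp
      | add x y _ _ hx hy => simp only [map_add, inner_add_left, hx, hy]
      | smul c x _ hx => simp only [map_smul, inner_smul_left, hx]
    simpa [hPF, hBF] using this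
  refine le_antisymm ?_ (le_iInf₂ fun g hg => ?_)
  · by_cases hfin : ∑' m, ‖⟪D (v m), φ⟫_ℂ‖ₑ ^ 2 = ⊤
    · rw [hfin]; exact le_top
    have hsum : Summable fun m => ‖⟪D (v m), φ⟫_ℂ‖ ^ 2 := by
      have := ENNReal.summable_toReal hfin
      simpa [ENNReal.toReal_pow, toReal_enorm] using this
    have hmem : Memℓp (fun m => ⟪D (v m), φ⟫_ℂ) 2 := by
      refine memℓp_gen ?_
      simpa using hsum
    -- Square-summable coefficients define the dual vector by Riesz–Fischer.
    let g : H := h.repr.symm ⟨_, hmem⟩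
    have hg : ∀ m, ⟪h m, g⟫_ℂ = ⟪D (v m), φ⟫_ℂ := fun m => by
      rw [← h.repr_apply_apply]; simp [g]
    refine (iInf₂_le g (hext g fun m => by rw [hv, hg])).trans_eq ?_
    -- Every admissible `g` has the same coefficients in the basis, so Parseval gives equality.
    rw [← tsum_enorm_sq_inner h]
    simp_rw [hg]
  · rw [← tsum_enorm_sq_inner h]
    refine le_of_eq (tsum_congr fun m => ?_)
    have hall : ∀ x, ⟪D x, φ⟫_ℂ = ⟪J x, g⟫_ℂ := fun x => by
      simp only [hJ, hD, Finsupp.linearCombination_apply, Finsupp.sum, sum_inner,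
        inner_smul_left, hg]
    rw [hall, hv]

end Hilbert

/-! ## Test functions -/

section TestFunctions

variable {κ : Type} [Fintype κ]

/-- The real function `u`, continuous with compact support, as an element of `L²`. -/
def ccVec (u : Config κ → ℝ) (hu : Continuous u) (hc : HasCompactSupport u) : WaveSpace κ :=
  ((Complex.continuous_ofReal.comp hu).memLp_of_hasCompactSupport (p := 2)
    (hc.comp_left Complex.ofReal_zero)).toLp _

theorem coeFn_ccVec (u : Config κ → ℝ) (hu : Continuous u) (hc : HasCompactSupport u) :
    ccVec u hu hc =ᵐ[volume] fun y => (u y : ℂ) :=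
  MemLp.coeFn_toLp _

theorem inner_ccVec (u : Config κ → ℝ) (hu : Continuous u) (hc : HasCompactSupport u)
    (φ : WaveSpace κ) : ⟪ccVec u hu hc, φ⟫_ℂ = ∫ y, u y • φ y := by
  rw [L2.inner_def]
  refine integral_congr_ae ?_
  filter_upwards [coeFn_ccVec u hu hc] with y hy
  rw [hy]
  simp [mul_comm]

theorem inner_ccVec_ccVec (u : Config κ → ℝ) (hu : Continuous u) (hc : HasCompactSupport u)
    (v : Config κ → ℝ) (hv : Continuous v) (hd : HasCompactSupport v) :
    ⟪ccVec u hu hc, ccVec v hv hd⟫_ℂ = ((∫ y, u y * v y : ℝ) : ℂ) := by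
  rw [inner_ccVec]
  refine Eq.trans ?_ integral_ofReal
  refine integral_congr_ae ?_
  filter_upwards [coeFn_ccVec v hv hd] with y hy
  rw [hy]
  simp

/-- Real smooth functions with compact support. -/
structure TestFun (κ : Type) [Fintype κ] where
  /-- the underlying function -/
  toFun : Config κ → ℝ
  contDiff : ContDiff ℝ ∞ toFun
  hasCompactSupport : HasCompactSupport toFun

instance : Nonempty (TestFun κ) := ⟨⟨0, contDiff_const, HasCompactSupport.zero⟩⟩

theorem continuous_fderiv_apply {χ : Config κ → ℝ} (h : ContDiff ℝ ∞ χ) (v : Config κ) :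
    Continuous fun y => fderiv ℝ χ y v :=
  (h.continuous_fderiv (by simp)).clm_apply continuous_const

/-- A test function as an element of `L²`. -/
def testVec (χ : TestFun κ) : WaveSpace κ := ccVec χ.toFun χ.contDiff.continuous χ.hasCompactSupport

/-- The function `y_j χ` as an element of `L²`. -/
def mulVec (j : κ) (χ : TestFun κ) : WaveSpace κ :=
  ccVec (fun y => y j * χ.toFun y) (Continuous.mul (by fun_prop) χ.contDiff.continuous) χ.hasCompactSupport.mul_left

/-- The function `∂_j χ` as an element of `L²`. -/
def derivVec [DecidableEq κ] (j : κ) (χ : TestFun κ) : WaveSpace κ :=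
  ccVec (fun y => fderiv ℝ χ.toFun y (EuclideanSpace.single j 1))
    (continuous_fderiv_apply χ.contDiff _) (χ.hasCompactSupport.fderiv_apply ℝ _)

theorem locallyIntegrable_coeFn (φ : WaveSpace κ) : LocallyIntegrable φ volume :=
  (Lp.memLp φ).locallyIntegrable (by norm_num)

theorem eq_zero_of_inner_testVec (g : WaveSpace κ) (h : ∀ χ, ⟪testVec χ, g⟫_ℂ = 0) : g = 0 := by
  rw [Lp.eq_zero_iff_ae_eq_zero]
  refine ae_eq_zero_of_integral_contDiff_smul_eq_zero (locallyIntegrable_coeFn g) fun χ h1 h2 => ?_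
  exact (inner_ccVec _ _ _ g).symm.trans (h ⟨χ, h1, h2⟩)

theorem inner_mulVec_testVec (j : κ) (χ χ' : TestFun κ) :
    ⟪mulVec j χ, testVec χ'⟫_ℂ = ⟪testVec χ, mulVec j χ'⟫_ℂ := by
  rw [mulVec, testVec, mulVec, testVec, inner_ccVec_ccVec, inner_ccVec_ccVec]
  congr 2
  funext y
  ring

theorem inner_derivVec_testVec [DecidableEq κ] (j : κ) (χ χ' : TestFun κ) :
    ⟪derivVec j χ, testVec χ'⟫_ℂ = -⟪testVec χ, derivVec j χ'⟫_ℂ := by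
  rw [derivVec, testVec, derivVec, testVec, inner_ccVec_ccVec, inner_ccVec_ccVec,
    integral_mul_fderiv_eq_neg_fderiv_mul_of_integrable]
  · simp
  · exact ((continuous_fderiv_apply χ.contDiff _).mul χ'.contDiff.continuous).integrable_of_hasCompactSupport
      χ'.hasCompactSupport.mul_left
  · exact (χ.contDiff.continuous.mul (continuous_fderiv_apply χ'.contDiff _)).integrable_of_hasCompactSupport
      χ.hasCompactSupport.mul_right
  · exact (χ.contDiff.continuous.mul χ'.contDiff.continuous).integrable_of_hasCompactSupport χ.hasCompactSupport.mul_right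
  · exact fun x _ => (χ.contDiff.differentiable (by simp)).differentiableAt
  · exact fun x _ => (χ'.contDiff.differentiable (by simp)).differentiableAt

theorem isWeakDeriv_iff [DecidableEq κ] (j : κ) (φ g : WaveSpace κ) :
    IsWeakDeriv j φ g ↔ ∀ χ, ⟪derivVec j χ, φ⟫_ℂ = -⟪testVec χ, g⟫_ℂ := by
  simp only [derivVec, testVec, inner_ccVec]
  exact ⟨fun h χ => h χ.toFun χ.contDiff χ.hasCompactSupport, fun h χ h1 h2 => h ⟨χ, h1, h2⟩⟩

end TestFunctions

/-! ## The cost form as a sum of squares -/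

section CostForm

variable {κ : Type} [Fintype κ]

theorem enorm_toLp_sq {f : Config κ → ℂ} (hf : MemLp f 2 volume) :
    ‖hf.toLp f‖ₑ ^ 2 = ∫⁻ y, ‖f y‖ₑ ^ 2 := by
  rw [Lp.enorm_toLp]
  have := eLpNorm_nnreal_pow_eq_lintegral (p := 2) (f := f) (μ := (volume : Measure (Config κ)))
    two_ne_zero
  simpa using this

theorem enorm_sq_eq_lintegral (φ : WaveSpace κ) : ‖φ‖ₑ ^ 2 = ∫⁻ y, ‖φ y‖ₑ ^ 2 := by
  rw [← enorm_toLp_sq (Lp.memLp φ), Lp.toLp_coeFn]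

/-- By the fundamental lemma of the calculus of variations the constraint says `g = (x_j - y_j) φ`
almost everywhere. If this function is not in `L²`, there is no competitor and both sides are `∞`.
-/
theorem positionCost_eq_iInf (x : Config κ) (j : κ) (φ : WaveSpace κ) :
    positionCost x j φ = ⨅ (g : WaveSpace κ)
      (_ : ∀ χ, ⟪(x j : ℂ) • testVec χ + -mulVec j χ, φ⟫_ℂ = ⟪testVec χ, g⟫_ℂ), ‖g‖ₑ ^ 2 := by
  have hinner : ∀ χ : TestFun κ, ⟪(x j : ℂ) • testVec χ + -mulVec j χ, φ⟫_ℂ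
      = ∫ y, χ.toFun y • ((x j - y j) • φ y) := fun χ => by
    have h1 : Integrable (fun y => χ.toFun y • φ y) :=
      (locallyIntegrable_coeFn φ).integrable_smul_left_of_hasCompactSupport χ.contDiff.continuous χ.hasCompactSupport
    have h2 : Integrable (fun y => (y j * χ.toFun y) • φ y) :=
      (locallyIntegrable_coeFn φ).integrable_smul_left_of_hasCompactSupport
        (Continuous.mul (by fun_prop) χ.contDiff.continuous) χ.hasCompactSupport.mul_left
    rw [inner_add_left, inner_neg_left, inner_smul_left, testVec, mulVec, inner_ccVec, inner_ccVec,
      Complex.conj_ofReal, ← sub_eq_add_neg, ← Complex.real_smul, ← integral_smul]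
    refine (integral_sub (h1.smul (x j)) h2).symm.trans ?_
    congr 1
    funext y
    simp only [Complex.real_smul, Pi.smul_apply]
    push_cast
    ring
  have hm : AEStronglyMeasurable (fun y : Config κ => (x j - y j) • φ y) volume :=
    (Continuous.aestronglyMeasurable (f := fun y : Config κ => x j - y j) (by fun_prop)).smul
      (Lp.aestronglyMeasurable φ)
  refine le_antisymm (le_iInf₂ fun g hg => ?_) ?_
  · have hl : LocallyIntegrable (fun y : Config κ => (x j - y j) • φ y) volume := by
      rw [← locallyIntegrableOn_univ]
      exact ((locallyIntegrable_coeFn φ).locallyIntegrableOn _).continuousOn_smul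
        isOpen_univ.isLocallyClosed (g := fun y : Config κ => x j - y j) (by fun_prop)
    have : ∀ᵐ y, (x j - y j) • φ y = g y := by
      refine ae_eq_of_integral_contDiff_smul_eq hl (locallyIntegrable_coeFn g) fun χ h1 h2 => ?_
      rw [← hinner ⟨χ, h1, h2⟩, hg, testVec, inner_ccVec]
    rw [enorm_sq_eq_lintegral, positionCost]
    refine le_of_eq (lintegral_congr_ae ?_)
    filter_upwards [this] with y hy
    rw [hy]
  · by_cases hfin : positionCost x j φ = ⊤
    · rw [hfin]; exact le_top
    have hL : MemLp (fun y : Config κ => (x j - y j) • φ y) 2 volume := by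
      refine ⟨hm, ?_⟩
      have := eLpNorm_nnreal_pow_eq_lintegral (p := 2) (f := fun y : Config κ => (x j - y j) • φ y)
        (μ := (volume : Measure (Config κ))) two_ne_zero
      simp only [NNReal.coe_ofNat, ENNReal.rpow_ofNat, ENNReal.coe_ofNat] at this
      have h2 : eLpNorm (fun y : Config κ => (x j - y j) • φ y) 2 volume ^ 2 ≠ ⊤ := by
        rw [this]; exact hfin
      exact lt_top_iff_ne_top.2 fun h => h2 (by rw [h]; simp)
    refine (iInf₂_le (hL.toLp _) fun χ => ?_).trans_eq (enorm_toLp_sq hL)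
    rw [hinner, testVec, inner_ccVec]
    refine integral_congr_ae ?_
    filter_upwards [hL.coeFn_toLp] with y hy
    rw [hy]

/-- The substitution `g ↦ ξ_j φ + iħ g` is a bijection from weak derivatives to dual vectors, as `ħ
≠ 0`. Conjugating `iħ` in the first slot of the inner product cancels the sign from integration by
parts. -/
theorem momentumCost_eq_iInf [DecidableEq κ] {ħ : ℝ} (hħ : ħ ≠ 0) (ξ : Config κ) (j : κ)
    (φ : WaveSpace κ) :
    momentumCost ħ ξ j φ = ⨅ (g : WaveSpace κ)
      (_ : ∀ χ, ⟪(ξ j : ℂ) • testVec χ + (I * (ħ : ℂ)) • derivVec j χ, φ⟫_ℂ = ⟪testVec χ, g⟫_ℂ),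
        ‖g‖ₑ ^ 2 := by
  have hI : I * (ħ : ℂ) ≠ 0 := mul_ne_zero I_ne_zero (by exact_mod_cast hħ)
  have key : ∀ g, IsWeakDeriv j φ g ↔
      ∀ χ, ⟪(ξ j : ℂ) • testVec χ + (I * (ħ : ℂ)) • derivVec j χ, φ⟫_ℂ
        = ⟪testVec χ, (ξ j : ℂ) • φ + (I * (ħ : ℂ)) • g⟫_ℂ := fun g => by
    rw [isWeakDeriv_iff]
    refine forall_congr' fun χ => ?_
    rw [inner_add_left, inner_add_right, inner_smul_left, inner_smul_left, inner_smul_right,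
      inner_smul_right]
    simp only [map_mul, conj_I, conj_ofReal, neg_mul, add_right_inj]
    rw [neg_eq_iff_eq_neg, ← mul_neg, mul_right_inj' hI]
  refine le_antisymm (le_iInf₂ fun g hg => ?_) (le_iInf₂ fun g hg => ?_)
  · have h1 : (ξ j : ℂ) • φ + (I * (ħ : ℂ)) • ((I * (ħ : ℂ))⁻¹ • (g - (ξ j : ℂ) • φ)) = g := by
      rw [smul_inv_smul₀ hI]; abel
    refine (iInf₂_le ((I * (ħ : ℂ))⁻¹ • (g - (ξ j : ℂ) • φ)) ?_).trans_eq (by rw [h1])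
    rw [key, h1]
    exact hg
  · exact iInf₂_le _ ((key g).1 hg)

/-- The `l`-th coordinate of a phase space point. -/
def phaseCoord (l : κ ⊕ κ) (z : Phase κ) : ℂ :=
  l.elim (fun j => (z.1 j : ℂ)) fun j => (z.2 j : ℂ)

theorem measurable_phaseCoord (l : κ ⊕ κ) : Measurable (phaseCoord l) := by
  rcases l with j | j
  · exact Continuous.measurable (by unfold phaseCoord; simp only [Sum.elim_inl]; fun_prop)
  · exact Continuous.measurable (by unfold phaseCoord; simp only [Sum.elim_inr]; fun_prop)

/-- The operators `-y_j` and `iħ∂_j` on test functions. -/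
def canonicalVec [DecidableEq κ] (ħ : ℝ) (l : κ ⊕ κ) (χ : TestFun κ) : WaveSpace κ :=
  l.elim (fun j => -mulVec j χ) fun j => (I * (ħ : ℂ)) • derivVec j χ

theorem inner_canonicalVec_testVec [DecidableEq κ] (ħ : ℝ) (l : κ ⊕ κ) (χ χ' : TestFun κ) :
    ⟪canonicalVec ħ l χ, testVec χ'⟫_ℂ = ⟪testVec χ, canonicalVec ħ l χ'⟫_ℂ := by
  rcases l with j | j
  · simp [canonicalVec, inner_mulVec_testVec]
  · simp [canonicalVec, inner_derivVec_testVec, inner_smul_left, inner_smul_right]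

theorem secondCountableTopology_waveSpace : SecondCountableTopology (WaveSpace κ) :=
  have : Fact ((2 : ℝ≥0∞) ≠ ⊤) := ⟨by simp⟩
  inferInstance

/-- The cost form is a countable sum of squares of linear forms depending affinely on `z`. -/
theorem exists_costForm_eq_tsum [DecidableEq κ] {ħ : ℝ} (hħ : ħ ≠ 0) :
    ∃ (L : Type) (_ : Countable L) (c : L → Phase κ → ℂ) (u u' : L → WaveSpace κ),
      (∀ l, Measurable (c l)) ∧ ∀ z φ,
        costForm ħ z φ = 2⁻¹ * ∑' l, ‖⟪c l z • u l + u' l, φ⟫_ℂ‖ₑ ^ 2 := by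
  -- The joint graph of all position and momentum operators: density in it yields one basis that
  -- serves every coordinate and every `z`.
  let F : TestFun κ → WaveSpace κ × (κ ⊕ κ → WaveSpace κ) :=
    fun χ => (testVec χ, fun l => canonicalVec ħ l χ)
  have : SecondCountableTopology (WaveSpace κ) := secondCountableTopology_waveSpace
  obtain ⟨M, h, v, s, hv, hs, hspan⟩ := exists_core_basis testVec F Prod.fst continuous_fst
    (fun _ => rfl) (fun g => eq_zero_of_inner_testVec g)
  refine ⟨(κ ⊕ κ) × M, inferInstance, fun l => phaseCoord l.1, fun l => h l.2,
    fun l => Finsupp.linearCombination ℂ (canonicalVec ħ l.1) (v l.2),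
    fun l => measurable_phaseCoord l.1, fun z φ => ?_⟩
  have key : ∀ l : κ ⊕ κ,
      (⨅ (g : WaveSpace κ) (_ : ∀ χ, ⟪phaseCoord l z • testVec χ + canonicalVec ħ l χ, φ⟫_ℂ
        = ⟪testVec χ, g⟫_ℂ), ‖g‖ₑ ^ 2)
      = ∑' m, ‖⟪phaseCoord l z • h m + Finsupp.linearCombination ℂ (canonicalVec ħ l) (v m),
          φ⟫_ℂ‖ₑ ^ 2 := fun l => by
    -- A real shift keeps the operator symmetric.
    have hreal : (starRingEnd ℂ) (phaseCoord l z) = phaseCoord l z := by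
      rcases l with j | j <;> simp [phaseCoord]
    rw [iInf_enorm_sq_eq_tsum (τ := testVec)
      (β := fun χ => phaseCoord l z • testVec χ + canonicalVec ħ l χ) (F := F) (P := Prod.fst)
      (B := fun p => phaseCoord l z • p.1 + p.2 l) continuous_fst (by fun_prop)
      (fun _ => rfl) (fun _ => rfl) (fun g => eq_zero_of_inner_testVec g) (fun χ χ' => by
        rw [inner_add_left, inner_add_right, inner_canonicalVec_testVec, inner_smul_left,
          inner_smul_right, hreal]) hv hs hspan]
    refine tsum_congr fun m => ?_
    rw [← hv m]
    simp only [Finsupp.linearCombination_apply, Finsupp.sum, smul_add, Finset.sum_add_distrib,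
      Finset.smul_sum, smul_comm (phaseCoord l z)]
  dsimp only
  rw [costForm, ENNReal.tsum_prod (f := fun l m => ‖⟪phaseCoord l z • h m
    + Finsupp.linearCombination ℂ (canonicalVec ħ l) (v m), φ⟫_ℂ‖ₑ ^ 2), tsum_fintype, Fintype.sum_sum_type, ← Finset.sum_add_distrib]
  congr 1
  refine Finset.sum_congr rfl fun j _ => ?_
  rw [positionCost_eq_iInf, momentumCost_eq_iInf hħ]
  exact congrArg₂ _ (key (Sum.inl j)) (key (Sum.inr j))

/-- The trace of the cost does not depend on the basis or on the choice of the square root. -/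
theorem costTrace_eq_tsum_basis [DecidableEq κ] {ħ : ℝ} (hħ : ħ ≠ 0) (z : Phase κ)
    {S T : WaveSpace κ →L[ℂ] WaveSpace κ} (hS : IsSelfAdjoint S) (hT : S * S = T) {ι : Type}
    (b : HilbertBasis ι ℂ (WaveSpace κ)) :
    costTrace ħ z T = ∑' k, costForm ħ z (S (b k)) := by
  obtain ⟨L, _, c, u, u', -, h⟩ := exists_costForm_eq_tsum (κ := κ) hħ
  -- After exchanging the two sums, Parseval removes the basis and the right side involves only `T`.
  have key : ∀ {A : WaveSpace κ →L[ℂ] WaveSpace κ} (_ : IsSelfAdjoint A) (_ : A * A = T)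
      {ι : Type} (b : HilbertBasis ι ℂ (WaveSpace κ)), ∑' k, costForm ħ z (A (b k))
        = 2⁻¹ * ∑' l, ENNReal.ofReal
          (⟪c l z • u l + u' l, T (c l z • u l + u' l)⟫_ℂ).re := by
    intro A hA hAT ι b
    simp_rw [h, ENNReal.tsum_mul_left]
    rw [ENNReal.tsum_comm]
    congr 1
    refine tsum_congr fun l => ?_
    rw [← enorm_sq_sqrt hA hAT, ← tsum_enorm_sq_inner b]
    refine tsum_congr fun k => ?_
    rw [← inner_apply_symm hA, enorm_inner_symm]
  rw [key hS hT b, ← key (isSelfAdjoint_opSqrt T)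
    (opSqrt_mul_self (isPositive_of_sqrt hS hT)) (stdBasis _)]
  rfl

/-- For positive `Q z` the cost trace is a countable sum of terms `⟨w_l(z), Q z w_l(z)⟩`. As `w_l`
is affine in a measurable scalar, each term expands into matrix elements of `Q z` between fixed
vectors, with measurable coefficients. -/
theorem aemeasurable_costTrace [DecidableEq κ] {ħ : ℝ} (hħ : ħ ≠ 0)
    {Q : Phase κ → (WaveSpace κ →L[ℂ] WaveSpace κ)}
    (hQ : ∀ φ ψ : WaveSpace κ, AEMeasurable fun z => ⟪φ, Q z ψ⟫_ℂ)
    (hpos : ∀ᵐ z, (Q z).IsPositive) : AEMeasurable fun z => costTrace ħ z (Q z) := by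
  obtain ⟨L, _, c, u, u', hc, h⟩ := exists_costForm_eq_tsum (κ := κ) hħ
  have hm : AEMeasurable fun z => 2⁻¹ * ∑' l, ENNReal.ofReal
      (⟪c l z • u l + u' l, Q z (c l z • u l + u' l)⟫_ℂ).re := by
    refine AEMeasurable.const_mul (AEMeasurable.tsum fun l => ?_) _
    refine ENNReal.measurable_ofReal.comp_aemeasurable
      (Complex.measurable_re.comp_aemeasurable ?_)
    have hcl : AEMeasurable (c l) := (hc l).aemeasurable
    have hcl' : AEMeasurable (fun z => (starRingEnd ℂ) (c l z)) :=
      Complex.continuous_conj.measurable.comp_aemeasurable hcl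
    simp only [map_add, map_smul, inner_add_left, inner_add_right, inner_smul_left,
      inner_smul_right]
    exact (hcl.mul ((hcl'.mul (hQ _ _)).add (hQ _ _))).add ((hcl'.mul (hQ _ _)).add (hQ _ _))
  refine hm.congr ?_
  filter_upwards [hpos] with z hz
  rw [costTrace]
  simp_rw [h, ENNReal.tsum_mul_left]
  rw [ENNReal.tsum_comm]
  congr 1
  refine tsum_congr fun l => ?_
  rw [← enorm_sq_sqrt (isSelfAdjoint_opSqrt _) (opSqrt_mul_self hz),
    ← tsum_enorm_sq_inner (stdBasis _)]
  refine tsum_congr fun k => ?_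
  rw [← inner_apply_symm (isSelfAdjoint_opSqrt _), enorm_inner_symm]

end CostForm

/-! ## Density of product vectors -/

section TensorBasis

variable {ι κ : Type} [Fintype ι] [Fintype κ]

/-- The identification of `(ℝ^κ)^ι`, as a Euclidean space, with a product of Euclidean spaces. -/
def partEquiv (ι κ : Type) [Fintype ι] [Fintype κ] : Config (ι × κ) ≃ᵐ (ι → Config κ) where
  toFun y i := part i y
  invFun a := WithLp.toLp 2 fun p => a p.1 p.2
  left_inv _ := rfl
  right_inv _ := rfl
  measurable_toFun := measurePreserving_part.measurable
  measurable_invFun := by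
    refine (WithLp.measurable_toLp 2 (ι × κ → ℝ)).comp (measurable_pi_lambda _ fun p => ?_)
    exact (measurable_pi_apply p.2).comp ((WithLp.measurable_ofLp 2 (κ → ℝ)).comp
      (measurable_pi_apply p.1))

theorem measurePreserving_partEquiv : MeasurePreserving (partEquiv ι κ) :=
  measurePreserving_part

theorem volume_partEquiv_preimage_pi (s : ι → Set (Config κ)) (hs : ∀ i, MeasurableSet (s i)) :
    volume (partEquiv ι κ ⁻¹' Set.univ.pi s) = ∏ i, volume (s i) := by
  rw [measurePreserving_partEquiv.measure_preimage
    (MeasurableSet.univ_pi hs).nullMeasurableSet, volume_pi_pi]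

theorem inner_tensorVec_indicator (s : ι → Set (Config κ)) (hs : ∀ i, MeasurableSet (s i))
    (hf : ∀ i, volume (s i) ≠ ⊤) (g : WaveSpace (ι × κ)) :
    ⟪tensorVec fun i => indicatorConstLp 2 (hs i) (hf i) (1 : ℂ), g⟫_ℂ
      = ∫ y in partEquiv ι κ ⁻¹' Set.univ.pi s, g y := by
  have hm : MeasurableSet (partEquiv ι κ ⁻¹' Set.univ.pi s) :=
    (partEquiv ι κ).measurable (MeasurableSet.univ_pi hs)
  rw [L2.inner_def, ← integral_indicator hm]
  refine integral_congr_ae ?_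
  have h : ∀ᵐ y : Config (ι × κ), ∀ i, indicatorConstLp 2 (hs i) (hf i) (1 : ℂ) (part i y)
      = (s i).indicator (fun _ => 1) (part i y) :=
    ae_all_iff.2 fun i => (quasiMeasurePreserving_part i).ae indicatorConstLp_coeFn
  filter_upwards [coeFn_tensorVec fun i => indicatorConstLp 2 (hs i) (hf i) (1 : ℂ), h] with y h1 h2
  rw [h1]
  simp only [h2]
  by_cases hy : y ∈ partEquiv ι κ ⁻¹' Set.univ.pi s
  · rw [Set.indicator_of_mem hy]
    have : ∀ i, part i y ∈ s i := fun i => hy i trivial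
    simp [this]
  · rw [Set.indicator_of_notMem hy]
    obtain ⟨i, hi⟩ : ∃ i, part i y ∉ s i := by
      by_contra! hc
      exact hy fun i _ => hc i
    rw [Finset.prod_eq_zero (Finset.mem_univ i) (Set.indicator_of_notMem hi _), inner_zero_left]

/-- Indicators of boxes of finite measure are product vectors, so `g` has zero integral over them. A
π-λ argument extends this to all measurable subsets of a bounded region, which forces `g = 0`. -/
theorem eq_zero_of_inner_tensorVec (g : WaveSpace (ι × κ))
    (h : ∀ φ : ι → WaveSpace κ, ⟪tensorVec φ, g⟫_ℂ = 0) : g = 0 := by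
  rw [Lp.eq_zero_iff_ae_eq_zero]
  let e := partEquiv ι κ
  -- Truncation is needed because an `L²` function need not be integrable on the whole space.
  let B : ℕ → Set (Config (ι × κ)) := fun n => e ⁻¹' Set.univ.pi fun _ => Metric.ball 0 n
  have hB : ∀ n, MeasurableSet (B n) := fun n =>
    e.measurable (MeasurableSet.univ_pi fun _ => measurableSet_ball)
  have hfin : ∀ n, volume (B n) < ⊤ := fun n => by
    rw [volume_partEquiv_preimage_pi _ fun _ => measurableSet_ball]
    exact ENNReal.prod_lt_top fun _ _ => measure_ball_lt_top
  have hint : ∀ n, Integrable g (volume.restrict (B n)) := fun n =>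
    have : IsFiniteMeasure (volume.restrict (B n)) := ⟨by simpa using hfin n⟩
    ((Lp.memLp g).restrict (B n)).integrable (by norm_num)
  have hbox : ∀ n (s : ι → Set (Config κ)), (∀ i, MeasurableSet (s i)) →
      ∫ y in e ⁻¹' Set.univ.pi s, g y ∂volume.restrict (B n) = 0 := fun n s hs => by
    rw [Measure.restrict_restrict (e.measurable (MeasurableSet.univ_pi hs)), ← Set.preimage_inter,
      ← Set.pi_inter_distrib]
    have hs' : ∀ i, MeasurableSet (s i ∩ Metric.ball 0 n) := fun i =>
      (hs i).inter measurableSet_ball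
    have hf' : ∀ i, volume (s i ∩ Metric.ball 0 (n : ℝ)) ≠ ⊤ := fun i =>
      ((measure_mono Set.inter_subset_right).trans_lt measure_ball_lt_top).ne
    rw [← h fun i => indicatorConstLp 2 (hs' i) (hf' i) 1, inner_tensorVec_indicator _ hs' hf']
  have hall : ∀ n (A : Set (ι → Config κ)), MeasurableSet A →
      ∫ y in e ⁻¹' A, g y ∂volume.restrict (B n) = 0 := fun n A hA => by
    refine MeasurableSpace.induction_on_inter
      (C := fun A _ => ∫ y in e ⁻¹' A, g y ∂volume.restrict (B n) = 0)
      generateFrom_pi.symm isPiSystem_pi (by simp) ?_ ?_ ?_ A hA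
    · rintro _ ⟨s, hs, rfl⟩
      exact hbox n s fun i => hs i trivial
    · intro A hA ih
      rw [Set.preimage_compl, setIntegral_compl (e.measurable hA) (hint n), ih, sub_zero]
      have := hbox n (fun _ => Set.univ) fun _ => MeasurableSet.univ
      simpa [Set.pi_univ] using this
    · intro f hd hf ih
      rw [Set.preimage_iUnion, integral_iUnion (fun i => e.measurable (hf i))
        (fun i j hij => (hd hij).preimage _) (hint n).integrableOn]
      simp [ih]
  have hzero : ∀ n, ∀ᵐ y, y ∈ B n → g y = 0 := fun n => by
    rw [← ae_restrict_iff' (hB n)]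
    refine (hint n).ae_eq_zero_of_forall_setIntegral_eq_zero fun A hA _ => ?_
    rw [← hall n (e.symm ⁻¹' A) (e.symm.measurable hA), ← Set.preimage_comp,
      e.symm_comp_self, Set.preimage_id]
  filter_upwards [ae_all_iff.2 hzero] with y hy
  obtain ⟨n, hn⟩ := exists_nat_gt (∑ i, ‖part i y‖)
  refine hy n fun i _ => ?_
  rw [mem_ball_zero_iff]
  exact (Finset.single_le_sum (fun i _ => norm_nonneg (part i y)) (Finset.mem_univ i)).trans_lt hn

theorem topologicalClosure_span_tensorVec :
    (Submodule.span ℂ (Set.range (tensorVec : (ι → WaveSpace κ) → WaveSpace (ι × κ)))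
      ).topologicalClosure = ⊤ := by
  rw [Submodule.topologicalClosure_eq_top_iff, Submodule.eq_bot_iff]
  intro g hg
  exact eq_zero_of_inner_tensorVec g fun φ =>
    (Submodule.mem_orthogonal _ _).1 hg _ (Submodule.subset_span ⟨φ, rfl⟩)

/-- A closed subspace containing all product vectors is everything. -/
theorem mem_of_isClosed_of_tensorVec (W : Submodule ℂ (WaveSpace (ι × κ)))
    (hW : IsClosed (W : Set (WaveSpace (ι × κ)))) (h : ∀ φ, tensorVec φ ∈ W)
    (x : WaveSpace (ι × κ)) : x ∈ W := by
  have h1 : (Submodule.span ℂ (Set.range (tensorVec : (ι → WaveSpace κ) → WaveSpace (ι × κ)))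
      ).topologicalClosure ≤ W :=
    Submodule.topologicalClosure_minimal _ (Submodule.span_le.2 (by rintro _ ⟨φ, rfl⟩; exact h φ))
      hW
  rw [topologicalClosure_span_tensorVec] at h1
  exact h1 trivial

/-! ### Product Hilbert bases -/

theorem norm_tensorVec (φ : ι → WaveSpace κ) : ‖tensorVec φ‖ = ∏ i, ‖φ i‖ := by
  have h := inner_tensorVec φ φ
  simp only [inner_self_eq_norm_sq_to_K] at h
  have h2 : ‖tensorVec φ‖ ^ 2 = (∏ i, ‖φ i‖) ^ 2 := by
    rw [← Finset.prod_pow]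
    exact_mod_cast h
  exact (pow_left_inj₀ (norm_nonneg _) (Finset.prod_nonneg fun _ _ => norm_nonneg _) two_ne_zero).1
    h2

/-- The map `a ↦ φ_1 ⊗ … ⊗ a ⊗ … ⊗ φ_N`, with `a` in the `i`-th place. -/
def tensorUpdate [DecidableEq ι] (φ : ι → WaveSpace κ) (i : ι) :
    WaveSpace κ →L[ℂ] WaveSpace (ι × κ) :=
  LinearMap.mkContinuous
    { toFun := fun a => tensorVec (Function.update φ i a)
      map_add' := tensorVec_update_add φ i
      map_smul' := tensorVec_update_smul φ i } (∏ j ∈ Finset.univ.erase i, ‖φ j‖) fun a => by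
    change ‖tensorVec (Function.update φ i a)‖ ≤ _
    rw [norm_tensorVec, ← Finset.prod_erase_mul _ _ (Finset.mem_univ i), Function.update_self]
    refine le_of_eq (congrArg (· * _) (Finset.prod_congr rfl fun j hj => ?_))
    rw [Function.update_of_ne (Finset.ne_of_mem_erase hj)]

theorem tensorUpdate_apply [DecidableEq ι] (φ : ι → WaveSpace κ) (i : ι) (a : WaveSpace κ) :
    tensorUpdate φ i a = tensorVec (Function.update φ i a) := rfl

/-- The slots are freed one at a time: `tensorUpdate` is linear and continuous in its slot, so
membership passes from basis vectors to the closure of their span. The finset `s` holds the slots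
already freed. -/
theorem tensorVec_mem_of_basis {K : Type} (b : HilbertBasis K ℂ (WaveSpace κ))
    (W : Submodule ℂ (WaveSpace (ι × κ))) (hW : IsClosed (W : Set (WaveSpace (ι × κ))))
    (h : ∀ k : ι → K, (tensorVec fun i => b (k i)) ∈ W) (φ : ι → WaveSpace κ) :
    tensorVec φ ∈ W := by
  classical
  have key : ∀ s : Finset ι, ∀ φ : ι → WaveSpace κ, (∀ i ∉ s, φ i ∈ Set.range b) →
      tensorVec φ ∈ W := by
    intro s
    induction s using Finset.induction_on with
    | empty =>
      intro φ hφ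
      choose k hk using fun i => hφ i (by simp)
      have := h k
      rwa [funext hk] at this
    | insert i s hi ih =>
      intro φ hφ
      have h1 : Submodule.span ℂ (Set.range b) ≤ W.comap (tensorUpdate φ i).toLinearMap := by
        rw [Submodule.span_le]
        rintro _ ⟨k, rfl⟩
        refine ih _ fun j hj => ?_
        by_cases hji : j = i
        · subst hji; simp
        · rw [Function.update_of_ne hji]
          exact hφ j (by simp [hji, hj])
      have h2 := Submodule.topologicalClosure_minimal _ h1
        (hW.preimage (tensorUpdate φ i).continuous)
      rw [b.dense_span] at h2
      have h3 : tensorUpdate φ i (φ i) ∈ W := h2 (x := φ i) trivial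
      rwa [tensorUpdate_apply, Function.update_eq_self] at h3
  exact key Finset.univ φ (by simp)

/-- The Hilbert basis of products of elements of a Hilbert basis. -/
theorem exists_tensorBasis {K : Type} (b : HilbertBasis K ℂ (WaveSpace κ)) :
    ∃ B : HilbertBasis (ι → K) ℂ (WaveSpace (ι × κ)), ∀ k, B k = tensorVec fun i => b (k i) := by
  classical
  have ho : Orthonormal ℂ fun k : ι → K => (tensorVec fun i => b (k i) : WaveSpace (ι × κ)) := by
    rw [orthonormal_iff_ite]
    intro k l
    rw [inner_tensorVec]
    simp only [orthonormal_iff_ite.1 b.orthonormal]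
    rw [Finset.prod_ite_zero]
    simp [funext_iff]
  have hd : (Submodule.span ℂ (Set.range fun k : ι → K =>
      (tensorVec fun i => b (k i) : WaveSpace (ι × κ))))ᗮ = ⊥ := by
    rw [Submodule.eq_bot_iff]
    intro g hg
    refine eq_zero_of_inner_tensorVec g fun φ => ?_
    have := tensorVec_mem_of_basis b (Submodule.span ℂ {g})ᗮ (Submodule.isClosed_orthogonal _)
      (fun k => ?_) φ
    · exact inner_eq_zero_symm.1 (Submodule.mem_orthogonal_singleton_iff_inner_right.1 this)
    · rw [Submodule.mem_orthogonal_singleton_iff_inner_left]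
      exact (Submodule.mem_orthogonal _ _).1 hg _ (Submodule.subset_span ⟨k, rfl⟩)
  exact ⟨HilbertBasis.mkOfOrthogonalEqBot ho hd, fun k => by
    rw [HilbertBasis.coe_mkOfOrthogonalEqBot]⟩

/-! ## Products of operators -/

theorem clm_ext_tensorVec {A A' : WaveSpace (ι × κ) →L[ℂ] WaveSpace (ι × κ)}
    (h : ∀ φ : ι → WaveSpace κ, A (tensorVec φ) = A' (tensorVec φ)) : A = A' := by
  refine ContinuousLinearMap.ext fun x => ?_
  exact mem_of_isClosed_of_tensorVec (LinearMap.eqLocus A.toLinearMap A'.toLinearMap)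
    (isClosed_eq A.continuous A'.continuous) h x

theorem tensorOp_mul (S S' : ι → WaveSpace κ →L[ℂ] WaveSpace κ) :
    tensorOp S * tensorOp S' = tensorOp fun i => S i * S' i :=
  clm_ext_tensorVec fun φ => by
    rw [mul_apply_eq_comp, tensorOp_tensorVec, tensorOp_tensorVec, tensorOp_tensorVec]
    rfl

theorem isSelfAdjoint_tensorOp {S : ι → WaveSpace κ →L[ℂ] WaveSpace κ}
    (hS : ∀ i, IsSelfAdjoint (S i)) : IsSelfAdjoint (tensorOp S) := by
  refine clm_ext_tensorVec fun φ => sub_eq_zero.1 (eq_zero_of_inner_tensorVec _ fun ψ => ?_)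
  rw [inner_sub_right, ContinuousLinearMap.star_eq_adjoint,
    ContinuousLinearMap.adjoint_inner_right, tensorOp_tensorVec, tensorOp_tensorVec,
    inner_tensorVec, inner_tensorVec, sub_eq_zero]
  exact Finset.prod_congr rfl fun i _ => inner_apply_symm (hS i) _ _

end TensorBasis

/-! ## Products of sums and integrals -/

section Products

theorem tsum_fin_prod {n : ℕ} {K : Type} (F : Fin n → K → ℝ≥0∞) :
    ∑' k : Fin n → K, ∏ i, F i (k i) = ∏ i, ∑' k, F i k := by
  induction n with
  | zero => simp
  | succ n ih =>
    rw [← (Fin.consEquiv fun _ => K).tsum_eq, Fin.prod_univ_succ, ← ih, ENNReal.tsum_prod',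
      ← ENNReal.tsum_mul_right]
    refine tsum_congr fun a => ?_
    rw [← ENNReal.tsum_mul_left]
    refine tsum_congr fun k => ?_
    simp [Fin.consEquiv, Fin.prod_univ_succ]

theorem lintegral_fin_prod {n : ℕ} {E : Type} [MeasureSpace E] [SigmaFinite (volume : Measure E)]
    (F : Fin n → E → ℝ≥0∞) (hF : ∀ i, AEMeasurable (F i)) :
    ∫⁻ x : Fin n → E, ∏ i, F i (x i) = ∏ i, ∫⁻ x, F i x := by
  induction n with
  | zero => simp [volume_pi]
  | succ n ih =>
    have hm : AEMeasurable fun x : Fin n → E => ∏ i, F (Fin.succ i) (x i) :=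
      Finset.aemeasurable_fun_prod _ fun i _ => (hF i.succ).comp_quasiMeasurePreserving
        (Measure.quasiMeasurePreserving_eval (fun _ : Fin n => (volume : Measure E)) i)
    rw [← (volume_preserving_piFinSuccAbove (fun _ : Fin (n + 1) => E) 0).symm.lintegral_comp_emb
      (MeasurableEquiv.measurableEmbedding _), Fin.prod_univ_succ, ← ih _ fun i => hF i.succ]
    rw [← lintegral_prod_mul (hF 0) hm]
    simp_rw [MeasurableEquiv.piFinSuccAbove_symm_apply, Fin.insertNthEquiv,
      Fin.prod_univ_succ, Fin.insertNth_zero, Equiv.coe_fn_mk, Fin.cons_succ, Fin.cons_zero]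
    rfl

theorem prod_ite_eq_mul_prod_erase {ι : Type} [Fintype ι] [DecidableEq ι] (i : ι)
    (x w : ι → ℝ≥0∞) :
    ∏ j, (if j = i then x j else w j) = x i * ∏ j ∈ Finset.univ.erase i, w j := by
  rw [← Finset.mul_prod_erase _ _ (Finset.mem_univ i), if_pos rfl]
  exact congrArg _ (Finset.prod_congr rfl fun j hj => if_neg (Finset.ne_of_mem_erase hj))

end Products

/-! ## The cost of a product vector -/

section TensorCost

variable {κ : Type} [Fintype κ]

/-- Configurations split into the `i`-th particle and the others. -/
def insertEquiv (κ : Type) [Fintype κ] {n : ℕ} (i : Fin (n + 1)) :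
    Config κ × (Fin n → Config κ) ≃ᵐ Config (Fin (n + 1) × κ) :=
  ((partEquiv (Fin (n + 1)) κ).trans
    (MeasurableEquiv.piFinSuccAbove (fun _ : Fin (n + 1) => Config κ) i)).symm

theorem measurePreserving_insertEquiv {n : ℕ} (i : Fin (n + 1)) :
    MeasurePreserving (insertEquiv κ i) :=
  ((volume_preserving_piFinSuccAbove (fun _ : Fin (n + 1) => Config κ) i).comp
    measurePreserving_partEquiv).symm
      ((partEquiv (Fin (n + 1)) κ).trans
        (MeasurableEquiv.piFinSuccAbove (fun _ : Fin (n + 1) => Config κ) i))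

theorem part_insertEquiv_self {n : ℕ} (i : Fin (n + 1)) (p : Config κ × (Fin n → Config κ)) :
    part i (insertEquiv κ i p) = p.1 := by
  have : part i (insertEquiv κ i p) = i.insertNth (α := fun _ => Config κ) p.1 p.2 i := rfl
  rw [this, Fin.insertNth_apply_same]

theorem part_insertEquiv_succAbove {n : ℕ} (i : Fin (n + 1)) (j : Fin n)
    (p : Config κ × (Fin n → Config κ)) :
    part (i.succAbove j) (insertEquiv κ i p) = p.2 j := by
  have : part (i.succAbove j) (insertEquiv κ i p)
    = i.insertNth (α := fun _ => Config κ) p.1 p.2 (i.succAbove j) := rfl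
  rw [this, Fin.insertNth_apply_succAbove]

/-- The inclusion of the configurations of the `i`-th particle. -/
def inclPart {ι : Type} [Fintype ι] [DecidableEq ι] (i : ι) : Config κ →L[ℝ] Config (ι × κ) :=
  LinearMap.toContinuousLinearMap
    { toFun := fun a => WithLp.toLp 2 fun p => if p.1 = i then a p.2 else 0
      map_add' := fun a b => by
        ext p
        by_cases h : p.1 = i <;> simp [h]
      map_smul' := fun c a => by
        ext p
        by_cases h : p.1 = i <;> simp [h] }

theorem inclPart_apply {ι : Type} [Fintype ι] [DecidableEq ι] (i : ι) (a : Config κ) (p : ι × κ) :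
    inclPart i a p = if p.1 = i then a p.2 else 0 := rfl

theorem inclPart_single {ι : Type} [Fintype ι] [DecidableEq ι] [DecidableEq κ] (i : ι) (k : κ) :
    inclPart i (EuclideanSpace.single k 1) = EuclideanSpace.single (i, k) 1 := by
  ext ⟨j, l⟩
  rw [inclPart_apply]
  by_cases h : j = i <;> by_cases h' : l = k <;> simp [h, h']

theorem insertEquiv_eq_add {n : ℕ} (i : Fin (n + 1)) (a : Config κ) (r : Fin n → Config κ) :
    insertEquiv κ i (a, r) = insertEquiv κ i (0, r) + inclPart i a := by
  ext ⟨j, k⟩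
  have h : ∀ b, insertEquiv κ i (b, r) (j, k) = part j (insertEquiv κ i (b, r)) k := fun _ => rfl
  rw [PiLp.add_apply, inclPart_apply, h, h]
  rcases Fin.eq_self_or_eq_succAbove i j with rfl | ⟨l, rfl⟩
  · simp [part_insertEquiv_self]
  · simp [part_insertEquiv_succAbove, Fin.succAbove_ne]

/-- Fubini with the `i`-th particle as the inner variable, so that a one-particle identity can be
applied on each slice. -/
theorem integral_smul_tensorVec {n : ℕ} (i : Fin (n + 1)) (ψ : Fin (n + 1) → WaveSpace κ)
    {u : Config (Fin (n + 1) × κ) → ℝ} (hu : Continuous u) (hc : HasCompactSupport u) :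
    ∫ y, u y • tensorVec ψ y = ∫ r : Fin n → Config κ,
      (∏ j, ψ (i.succAbove j) (r j)) * ∫ a, u (insertEquiv κ i (a, r)) • ψ i a := by
  have hE := measurePreserving_insertEquiv (κ := κ) i
  have hint : Integrable fun y => u y • tensorVec ψ y :=
    (locallyIntegrable_coeFn _).integrable_smul_left_of_hasCompactSupport hu hc
  have hae : (fun p => u (insertEquiv κ i p) • tensorVec ψ (insertEquiv κ i p)) =ᵐ[volume]
      fun p : Config κ × (Fin n → Config κ) => (∏ j, ψ (i.succAbove j) (p.2 j)) *
        (u (insertEquiv κ i p) • ψ i p.1) := by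
    filter_upwards [hE.quasiMeasurePreserving.ae (coeFn_tensorVec ψ)] with p hp
    rw [hp, Fin.prod_univ_succAbove _ i, part_insertEquiv_self]
    simp only [part_insertEquiv_succAbove, Complex.real_smul]
    ring
  have hint' := ((hE.integrable_comp_emb (insertEquiv κ i).measurableEmbedding).2 hint).congr hae
  rw [← hE.integral_comp (insertEquiv κ i).measurableEmbedding, integral_congr_ae hae]
  refine (integral_prod_symm _ hint').trans ?_
  refine integral_congr_ae (Filter.Eventually.of_forall fun r => ?_)
  exact integral_const_mul (∏ j, ψ (i.succAbove j) (r j) : ℂ)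
    fun a => u (insertEquiv κ i (a, r)) • ψ i a

/-- With the other particles frozen, a test function restricts to a one-particle test function whose
`k`-th derivative is the `(i, k)`-th derivative of the original. The hypothesis applies to each
slice. -/
theorem IsWeakDeriv.tensorVec [DecidableEq κ] {n : ℕ} (φ : Fin (n + 1) → WaveSpace κ)
    (i : Fin (n + 1)) (k : κ) {g : WaveSpace κ} (hg : IsWeakDeriv k (φ i) g) :
    IsWeakDeriv (i, k) (tensorVec φ) (tensorVec (Function.update φ i g)) := by
  intro χ h1 h2
  rw [integral_smul_tensorVec i φ (continuous_fderiv_apply h1 _) (h2.fderiv_apply ℝ _),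
    integral_smul_tensorVec i _ h1.continuous h2, ← integral_neg]
  congr 1
  funext r
  have hfun : (fun a => χ (insertEquiv κ i (a, r)))
      = fun a => χ (insertEquiv κ i (0, r) + inclPart i a) :=
    funext fun a => congrArg χ (insertEquiv_eq_add i a r)
  have hsm : ContDiff ℝ ∞ fun a => χ (insertEquiv κ i (a, r)) := by
    rw [hfun]
    have : ContDiff ℝ ∞ fun a : Config κ => inclPart i a := by fun_prop
    exact h1.comp (contDiff_const.add this)
  have hpart : Continuous (part i : Config (Fin (n + 1) × κ) → Config κ) := by
    unfold part
    fun_prop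
  have hcs : HasCompactSupport fun a => χ (insertEquiv κ i (a, r)) := by
    -- The slice is supported in the projection of the compact support of `χ`.
    refine HasCompactSupport.intro (h2.isCompact.image hpart) fun a ha => ?_
    by_contra hne
    exact ha ⟨insertEquiv κ i (a, r), subset_tsupport _ hne, part_insertEquiv_self _ _⟩
  have hder : ∀ a, fderiv ℝ (fun a => χ (insertEquiv κ i (a, r))) a (EuclideanSpace.single k 1)
      = fderiv ℝ χ (insertEquiv κ i (a, r)) (EuclideanSpace.single (i, k) 1) := fun a => by
    have hd : HasFDerivAt (fun a => χ (insertEquiv κ i (0, r) + inclPart i a))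
        ((fderiv ℝ χ (insertEquiv κ i (0, r) + inclPart i a)).comp (inclPart i)) a :=
      ((h1.differentiable (by simp)).differentiableAt.hasFDerivAt).comp a
        ((inclPart i).hasFDerivAt.const_add _)
    rw [hfun, hd.fderiv, ContinuousLinearMap.comp_apply, inclPart_single, insertEquiv_eq_add i a r]
  have hw := hg _ hsm hcs
  simp only [hder] at hw
  rw [hw, mul_neg, Function.update_self]
  simp only [Function.update_of_ne (Fin.succAbove_ne i _)]

theorem enorm_sq_tensorVec {ι : Type} [Fintype ι] (φ : ι → WaveSpace κ) :
    ‖tensorVec φ‖ₑ ^ 2 = ∏ i, ‖φ i‖ₑ ^ 2 := by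
  rw [Finset.prod_pow]
  congr 1
  simp only [← ofReal_norm]
  rw [norm_tensorVec, ENNReal.ofReal_prod_of_nonneg fun _ _ => norm_nonneg _]

theorem enorm_sq_tensorUpdate {ι : Type} [Fintype ι] [DecidableEq ι] (φ : ι → WaveSpace κ) (i : ι)
    (a : WaveSpace κ) :
    ‖tensorUpdate φ i a‖ₑ ^ 2 = ‖a‖ₑ ^ 2 * ∏ j ∈ Finset.univ.erase i, ‖φ j‖ₑ ^ 2 := by
  rw [tensorUpdate_apply, enorm_sq_tensorVec, ← Finset.mul_prod_erase _ _ (Finset.mem_univ i),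
    Function.update_self]
  exact congrArg _ (Finset.prod_congr rfl fun j hj => by
    rw [Function.update_of_ne (Finset.ne_of_mem_erase hj)])

/-- A weak derivative of `φ i`, tensored with the other factors, is a competitor on the left; the
upper bound is all that is needed. -/
theorem momentumCost_tensorVec_le [DecidableEq κ] {n : ℕ} (ħ : ℝ) (φ : Fin n → WaveSpace κ)
    (ξ : Config (Fin n × κ)) (i : Fin n) (k : κ) :
    momentumCost ħ ξ (i, k) (tensorVec φ)
      ≤ momentumCost ħ (part i ξ) k (φ i) * ∏ j ∈ Finset.univ.erase i, ‖φ j‖ₑ ^ 2 := by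
  obtain _ | n := n
  · exact i.elim0
  have hself : tensorVec φ = tensorUpdate φ i (φ i) := by
    rw [tensorUpdate_apply, Function.update_eq_self]
  set C := ∏ j ∈ Finset.univ.erase i, ‖φ j‖ₑ ^ 2 with hC
  have hle : ∀ g, IsWeakDeriv k (φ i) g → momentumCost ħ ξ (i, k) (tensorVec φ)
      ≤ ‖(part i ξ k : ℂ) • φ i + (I * (ħ : ℂ)) • g‖ₑ ^ 2 * C := fun g hg => by
    refine (iInf₂_le _ (hg.tensorVec φ i k)).trans_eq ?_
    rw [← enorm_sq_tensorUpdate, map_add, map_smul, map_smul, ← hself, tensorUpdate_apply]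
    rfl
  -- If `C = 0`, the right side is `0` even when the one-particle cost is `∞`, as `∞ * 0 = 0`. The
  -- product vector then vanishes and has weak derivative `0`.
  by_cases h0 : C = 0
  · have hz : tensorVec φ = 0 := by
      have := enorm_sq_tensorUpdate φ i (φ i)
      rw [← hself, ← hC, h0, mul_zero] at this
      simpa using this
    rw [h0, mul_zero, hz]
    refine (iInf₂_le 0 fun χ _ _ => ?_).trans_eq (by simp)
    simp
  · have htop : C ≠ ⊤ := ENNReal.prod_ne_top fun j _ => by simp
    rw [← ENNReal.div_le_iff h0 htop]
    exact le_iInf₂ fun g hg => ENNReal.div_le_of_le_mul (hle g hg)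

theorem positionCost_tensorVec [DecidableEq κ] {n : ℕ} (φ : Fin n → WaveSpace κ)
    (x : Config (Fin n × κ)) (i : Fin n) (k : κ) :
    positionCost x (i, k) (tensorVec φ)
      = positionCost (part i x) k (φ i) * ∏ j ∈ Finset.univ.erase i, ‖φ j‖ₑ ^ 2 := by
  have hm : ∀ j, AEMeasurable fun y : Config κ =>
      if j = i then ‖(part i x k - y k) • φ j y‖ₑ ^ 2 else ‖φ j y‖ₑ ^ 2 := fun j => by
    by_cases h : j = i
    · simp only [h, if_true]
      exact (((Continuous.aestronglyMeasurable (f := fun y : Config κ => part i x k - y k)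
        (by fun_prop)).smul (Lp.aestronglyMeasurable _)).enorm).pow_const 2
    · simp only [h, if_false]
      exact (Lp.aestronglyMeasurable _).enorm.pow_const 2
  have h1 := lintegral_fin_prod (n := n) _ hm
  rw [← measurePreserving_part.lintegral_comp_emb
    (partEquiv (Fin n) κ).measurableEmbedding] at h1
  have h2 : ∏ j, ∫⁻ y : Config κ, (if j = i then ‖(part i x k - y k) • φ j y‖ₑ ^ 2
      else ‖φ j y‖ₑ ^ 2)
      = positionCost (part i x) k (φ i) * ∏ j ∈ Finset.univ.erase i, ‖φ j‖ₑ ^ 2 := by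
    rw [← prod_ite_eq_mul_prod_erase i (fun j => positionCost (part i x) k (φ j))]
    refine Finset.prod_congr rfl fun j _ => ?_
    by_cases h : j = i
    · simp only [h, if_true]; rfl
    · simp only [h, if_false, enorm_sq_eq_lintegral]
  rw [← h2, ← h1, positionCost]
  refine lintegral_congr_ae ?_
  filter_upwards [coeFn_tensorVec φ] with y hy
  rw [hy, prod_ite_eq_mul_prod_erase i (fun j => ‖(part i x k - part j y k) • φ j (part j y)‖ₑ ^ 2),
    ← Finset.mul_prod_erase _ _ (Finset.mem_univ i), ← smul_mul_assoc, enorm_mul, mul_pow]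
  congr 1
  rw [Finset.prod_pow]
  congr 1
  simp only [← ofReal_norm]
  rw [norm_prod, ENNReal.ofReal_prod_of_nonneg fun _ _ => norm_nonneg _]

theorem costForm_tensorVec_le [DecidableEq κ] {n : ℕ} (ħ : ℝ) (z : Phase (Fin n × κ))
    (φ : Fin n → WaveSpace κ) :
    costForm ħ z (tensorVec φ) ≤ ∑ i, costForm ħ (part i z.1, part i z.2) (φ i)
      * ∏ j ∈ Finset.univ.erase i, ‖φ j‖ₑ ^ 2 := by
  simp only [costForm]
  rw [Fintype.sum_prod_type, Finset.mul_sum]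
  refine Finset.sum_le_sum fun i _ => ?_
  rw [mul_assoc, Finset.sum_mul]
  gcongr with k
  rw [add_mul, positionCost_tensorVec]
  gcongr
  exact momentumCost_tensorVec_le ħ φ z.2 i k

end TensorCost

/-! ## Products of couplings -/

section TensorCoupling

variable {κ : Type} [Fintype κ]

/-- The identification of the phase space of `N` particles with a product of phase spaces. -/
def phaseEquiv (ι κ : Type) [Fintype ι] [Fintype κ] : Phase (ι × κ) ≃ᵐ (ι → Phase κ) :=
  ((partEquiv ι κ).prodCongr (partEquiv ι κ)).trans
    (MeasurableEquiv.arrowProdEquivProdArrow (Config κ) (Config κ) ι).symm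

theorem measurePreserving_phaseEquiv {ι : Type} [Fintype ι] :
    MeasurePreserving (phaseEquiv ι κ) :=
  (volume_measurePreserving_arrowProdEquivProdArrow (Config κ) (Config κ) ι).symm.comp
    (measurePreserving_partEquiv.prod measurePreserving_partEquiv)

theorem quasiMeasurePreserving_phaseEquiv {ι : Type} [Fintype ι] (i : ι) :
    Measure.QuasiMeasurePreserving fun z : Phase (ι × κ) => phaseEquiv ι κ z i :=
  (Measure.quasiMeasurePreserving_eval (fun _ : ι => (volume : Measure (Phase κ))) i).comp
    measurePreserving_phaseEquiv.quasiMeasurePreserving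

theorem tensorDensity_eq {ι : Type} [Fintype ι] (f : ι → Phase κ → ℝ) (z : Phase (ι × κ)) :
    tensorDensity f z = ∏ i, f i (phaseEquiv ι κ z i) := rfl

theorem integrable_tensorDensity {ι : Type} [Fintype ι] {f : ι → Phase κ → ℝ}
    (hf : ∀ i, Integrable (f i)) : Integrable (tensorDensity f) :=
  measurePreserving_phaseEquiv.integrable_comp_of_integrable
    (Integrable.fintype_prod (μ := fun _ : ι => (volume : Measure (Phase κ))) hf)

/-- In each argument separately, the vectors giving a measurable function form a subspace closed
under limits of sequences, so product vectors suffice. -/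
theorem aemeasurable_inner_of_tensorVec {ι X : Type} [Fintype ι] [MeasurableSpace X]
    {μ : Measure X} {A : X → (WaveSpace (ι × κ) →L[ℂ] WaveSpace (ι × κ))}
    (h : ∀ φ ψ : ι → WaveSpace κ, AEMeasurable (fun z => ⟪tensorVec φ, A z (tensorVec ψ)⟫_ℂ) μ)
    (x y : WaveSpace (ι × κ)) : AEMeasurable (fun z => ⟪x, A z y⟫_ℂ) μ := by
  have h1 : ∀ φ : ι → WaveSpace κ, AEMeasurable (fun z => ⟪tensorVec φ, A z y⟫_ℂ) μ := fun φ => by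
    refine mem_of_isClosed_of_tensorVec
      { carrier := {y | AEMeasurable (fun z => ⟪tensorVec φ, A z y⟫_ℂ) μ}
        add_mem' := fun {a b} ha hb => ?_
        zero_mem' := ?_
        smul_mem' := fun c a ha => ?_ } (IsSeqClosed.isClosed fun u y hu hy => ?_) (h φ) y
    · simp only [Set.mem_ofPred_eq, map_add, inner_add_right] at ha hb ⊢
      exact ha.add hb
    · simp
    · simp only [Set.mem_ofPred_eq, map_smul, inner_smul_right] at ha ⊢
      exact ha.const_mul c
    · exact aemeasurable_of_tendsto_metrizable_ae' hu (Filter.Eventually.of_forall fun z =>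
        (Continuous.tendsto (f := fun y => ⟪tensorVec φ, A z y⟫_ℂ) (by fun_prop) y).comp hy)
  refine mem_of_isClosed_of_tensorVec
    { carrier := {x | AEMeasurable (fun z => ⟪x, A z y⟫_ℂ) μ}
      add_mem' := fun {a b} ha hb => ?_
      zero_mem' := ?_
      smul_mem' := fun c a ha => ?_ } (IsSeqClosed.isClosed fun u x hu hx => ?_) h1 x
  · simp only [Set.mem_ofPred_eq, inner_add_left] at ha hb ⊢
    exact ha.add hb
  · simp
  · simp only [Set.mem_ofPred_eq, inner_smul_left] at ha ⊢
    exact ha.const_mul _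
  · exact aemeasurable_of_tendsto_metrizable_ae' hu (Filter.Eventually.of_forall fun z =>
      ((Continuous.tendsto (f := fun x => ⟪x, A z y⟫_ℂ) (by fun_prop) x).comp hx))

/-- Again the admissible vectors form a closed subspace in each argument; here closedness comes from
dominated convergence under the bound `hb`. -/
theorem weakIntegral_eq_of_tensorVec {ι X : Type} [Fintype ι] [MeasurableSpace X]
    {μ : Measure X} {A : X → (WaveSpace (ι × κ) →L[ℂ] WaveSpace (ι × κ))}
    {B : WaveSpace (ι × κ) →L[ℂ] WaveSpace (ι × κ)} {p : X → ℝ} (hp : Integrable p μ)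
    (hm : ∀ x y, AEMeasurable (fun z => ⟪x, A z y⟫_ℂ) μ)
    (hb : ∀ᵐ z ∂μ, ∀ x y, ‖⟪x, A z y⟫_ℂ‖ ≤ ‖x‖ * ‖y‖ * p z)
    (h : ∀ φ ψ : ι → WaveSpace κ,
      ∫ z, ⟪tensorVec φ, A z (tensorVec ψ)⟫_ℂ ∂μ = ⟪tensorVec φ, B (tensorVec ψ)⟫_ℂ)
    (x y : WaveSpace (ι × κ)) : ∫ z, ⟪x, A z y⟫_ℂ ∂μ = ⟪x, B y⟫_ℂ := by
  have hint : ∀ x y, Integrable (fun z => ⟪x, A z y⟫_ℂ) μ := fun x y =>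
    (hp.const_mul (‖x‖ * ‖y‖)).mono' (hm x y).aestronglyMeasurable
      (hb.mono fun z hz => hz x y)
  have hlim : ∀ (u v : ℕ → WaveSpace (ι × κ)) (x y : WaveSpace (ι × κ)),
      Filter.Tendsto u Filter.atTop (nhds x) → Filter.Tendsto v Filter.atTop (nhds y) →
      (∀ n, ∫ z, ⟪u n, A z (v n)⟫_ℂ ∂μ = ⟪u n, B (v n)⟫_ℂ) →
      ∫ z, ⟪x, A z y⟫_ℂ ∂μ = ⟪x, B y⟫_ℂ := by
    intro u v x y hu hv huv
    obtain ⟨C, hC⟩ := hu.norm.bddAbove_range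
    obtain ⟨D, hD⟩ := hv.norm.bddAbove_range
    have hC' : ∀ n, ‖u n‖ ≤ C := fun n => hC ⟨n, rfl⟩
    have hD' : ∀ n, ‖v n‖ ≤ D := fun n => hD ⟨n, rfl⟩
    have h1 : Filter.Tendsto (fun n => ∫ z, ⟪u n, A z (v n)⟫_ℂ ∂μ) Filter.atTop
        (nhds (∫ z, ⟪x, A z y⟫_ℂ ∂μ)) := by
      refine tendsto_integral_of_dominated_convergence (fun z => C * D * |p z|)
        (fun n => (hint _ _).aestronglyMeasurable) (hp.abs.const_mul _) (fun n => ?_)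
        (Filter.Eventually.of_forall fun z => hu.inner (((A z).continuous.tendsto y).comp hv))
      filter_upwards [hb] with z hz
      refine (hz _ _).trans ?_
      have hC0 := (norm_nonneg _).trans (hC' n)
      calc ‖u n‖ * ‖v n‖ * p z ≤ ‖u n‖ * ‖v n‖ * |p z| := by gcongr; exact le_abs_self _
        _ ≤ C * D * |p z| := by gcongr; exacts [hC' n, hD' n]
    have h2 : Filter.Tendsto (fun n => ⟪u n, B (v n)⟫_ℂ) Filter.atTop (nhds ⟪x, B y⟫_ℂ) :=
      hu.inner ((B.continuous.tendsto y).comp hv)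
    exact tendsto_nhds_unique h1 (by simpa only [huv] using h2)
  have h1 : ∀ φ : ι → WaveSpace κ, ∫ z, ⟪tensorVec φ, A z y⟫_ℂ ∂μ = ⟪tensorVec φ, B y⟫_ℂ :=
    fun φ => by
    refine mem_of_isClosed_of_tensorVec
      { carrier := {y | ∫ z, ⟪tensorVec φ, A z y⟫_ℂ ∂μ = ⟪tensorVec φ, B y⟫_ℂ}
        add_mem' := fun {a b} ha hb => ?_
        zero_mem' := by simp
        smul_mem' := fun c a ha => ?_ } (IsSeqClosed.isClosed fun u y hu hy =>
          hlim _ u _ y tendsto_const_nhds hy hu) (h φ) y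
    · simp only [Set.mem_ofPred_eq, map_add, inner_add_right] at ha hb ⊢
      rw [integral_add (hint _ _) (hint _ _), ha, hb]
    · simp only [Set.mem_ofPred_eq, map_smul, inner_smul_right] at ha ⊢
      rw [integral_const_mul, ha]
  refine mem_of_isClosed_of_tensorVec
    { carrier := {x | ∫ z, ⟪x, A z y⟫_ℂ ∂μ = ⟪x, B y⟫_ℂ}
      add_mem' := fun {a b} ha hb => ?_
      zero_mem' := by simp
      smul_mem' := fun c a ha => ?_ } (IsSeqClosed.isClosed fun u x hu hx =>
        hlim u _ x _ hx tendsto_const_nhds hu) h1 x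
  · simp only [Set.mem_ofPred_eq, inner_add_left] at ha hb ⊢
    rw [integral_add (hint _ _) (hint _ _), ha, hb]
  · simp only [Set.mem_ofPred_eq, inner_smul_left] at ha ⊢
    rw [integral_const_mul, ha]

/-! ### Trace and cost of tensor products of operators -/

theorem isSelfAdjoint_tensorOp_opSqrt {ι : Type} [Fintype ι]
    (T : ι → WaveSpace κ →L[ℂ] WaveSpace κ) :
    IsSelfAdjoint (tensorOp fun i => opSqrt (T i)) :=
  isSelfAdjoint_tensorOp fun i => isSelfAdjoint_opSqrt (T i)

theorem tensorOp_opSqrt_mul_self {ι : Type} [Fintype ι] {T : ι → WaveSpace κ →L[ℂ] WaveSpace κ}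
    (hT : ∀ i, (T i).IsPositive) :
    (tensorOp fun i => opSqrt (T i)) * (tensorOp fun i => opSqrt (T i)) = tensorOp T := by
  rw [tensorOp_mul]
  exact congrArg tensorOp (funext fun i => opSqrt_mul_self (hT i))

theorem posTrace_tensorOp {n : ℕ} {T : Fin n → WaveSpace κ →L[ℂ] WaveSpace κ}
    (hT : ∀ i, (T i).IsPositive) : posTrace (tensorOp T) = ∏ i, posTrace (T i) := by
  obtain ⟨B, hB⟩ := exists_tensorBasis (ι := Fin n) (stdBasis (WaveSpace κ))
  rw [posTrace_eq_tsum (isSelfAdjoint_tensorOp_opSqrt T) (tensorOp_opSqrt_mul_self hT) B]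
  simp_rw [hB, tensorOp_tensorVec, enorm_sq_tensorVec]
  rw [tsum_fin_prod fun i k => ‖opSqrt (T i) (stdBasis (WaveSpace κ) k)‖ₑ ^ 2]
  exact Finset.prod_congr rfl fun i _ =>
    (posTrace_eq_tsum (isSelfAdjoint_opSqrt _) (opSqrt_mul_self (hT i)) _).symm

/-- In a product basis, the product of square roots yields product vectors, to which
`costForm_tensorVec_le` applies. The sum over multi-indices then factorises. -/
theorem costTrace_tensorOp_le [DecidableEq κ] {n : ℕ} {ħ : ℝ} (hħ : ħ ≠ 0)
    {T : Fin n → WaveSpace κ →L[ℂ] WaveSpace κ} (hT : ∀ i, (T i).IsPositive)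
    (z : Phase (Fin n × κ)) :
    costTrace ħ z (tensorOp T) ≤ ∑ i, ∏ j, if j = i
      then costTrace ħ (phaseEquiv (Fin n) κ z j) (T j) else posTrace (T j) := by
  obtain ⟨B, hB⟩ := exists_tensorBasis (ι := Fin n) (stdBasis (WaveSpace κ))
  rw [costTrace_eq_tsum_basis hħ z (isSelfAdjoint_tensorOp_opSqrt T)
    (tensorOp_opSqrt_mul_self hT) B]
  simp_rw [hB, tensorOp_tensorVec]
  refine (ENNReal.tsum_le_tsum fun k => costForm_tensorVec_le ħ z _).trans_eq ?_
  rw [Summable.tsum_finsetSum fun _ _ => ENNReal.summable]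
  refine Finset.sum_congr rfl fun i _ => ?_
  have h : ∀ j, (if j = i then costTrace ħ (phaseEquiv (Fin n) κ z j) (T j) else posTrace (T j))
      = ∑' k, if j = i
        then costForm ħ (phaseEquiv (Fin n) κ z j) (opSqrt (T j) (stdBasis (WaveSpace κ) k))
        else ‖opSqrt (T j) (stdBasis (WaveSpace κ) k)‖ₑ ^ 2 := fun j => by
    by_cases hj : j = i
    · simp only [hj, if_true]; rfl
    · simp only [hj, if_false]
      exact posTrace_eq_tsum (isSelfAdjoint_opSqrt _) (opSqrt_mul_self (hT j)) _
  simp_rw [h]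
  rw [← tsum_fin_prod]
  refine tsum_congr fun k => ?_
  rw [prod_ite_eq_mul_prod_erase i (fun j => costForm ħ (phaseEquiv (Fin n) κ z j)
    (opSqrt (T j) (stdBasis (WaveSpace κ) (k j))))]
  rfl

/-- The pointwise tensor product of operator-valued functions on phase space. -/
def tensorCoupling {ι : Type} [Fintype ι] (Q : ι → Phase κ → (WaveSpace κ →L[ℂ] WaveSpace κ))
    (z : Phase (ι × κ)) : WaveSpace (ι × κ) →L[ℂ] WaveSpace (ι × κ) :=
  tensorOp fun i => Q i (phaseEquiv ι κ z i)

theorem inner_tensorCoupling {ι : Type} [Fintype ι]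
    (Q : ι → Phase κ → (WaveSpace κ →L[ℂ] WaveSpace κ)) (z : Phase (ι × κ))
    (φ ψ : ι → WaveSpace κ) :
    ⟪tensorVec φ, tensorCoupling Q z (tensorVec ψ)⟫_ℂ
      = ∏ i, ⟪φ i, Q i (phaseEquiv ι κ z i) (ψ i)⟫_ℂ := by
  rw [tensorCoupling, tensorOp_tensorVec, inner_tensorVec]

variable {n : ℕ} {f : Fin n → Phase κ → ℝ} {R : Fin n → WaveSpace κ →L[ℂ] WaveSpace κ}
  {Q : Fin n → Phase κ → (WaveSpace κ →L[ℂ] WaveSpace κ)}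

theorem ae_isPositive_factors (hQ : ∀ i, IsCoupling (f i) (R i) (Q i)) :
    ∀ᵐ z : Phase (Fin n × κ), ∀ i, (Q i (phaseEquiv (Fin n) κ z i)).IsPositive :=
  ae_all_iff.2 fun i => (quasiMeasurePreserving_phaseEquiv i).ae (hQ i).isPositive

theorem isCoupling_tensorCoupling (hf : ∀ i, IsProbabilityDensity (f i))
    (hQ : ∀ i, IsCoupling (f i) (R i) (Q i)) :
    IsCoupling (tensorDensity f) (tensorOp R) (tensorCoupling Q) := by
  -- Nonnegativity is what allows `ENNReal.ofReal` to be distributed over the product of the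
  -- densities.
  have hnn : ∀ᵐ z : Phase (Fin n × κ), ∀ i, 0 ≤ f i (phaseEquiv (Fin n) κ z i) :=
    ae_all_iff.2 fun i => (quasiMeasurePreserving_phaseEquiv i).ae (hf i).nonneg
  have htr : ∀ᵐ z : Phase (Fin n × κ), ∀ i, posTrace (Q i (phaseEquiv (Fin n) κ z i))
      = ENNReal.ofReal (f i (phaseEquiv (Fin n) κ z i)) :=
    ae_all_iff.2 fun i => (quasiMeasurePreserving_phaseEquiv i).ae (hQ i).trace_eq
  have hm : ∀ x y, AEMeasurable fun z : Phase (Fin n × κ) => ⟪x, tensorCoupling Q z y⟫_ℂ :=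
    aemeasurable_inner_of_tensorVec fun φ ψ => by
      simp_rw [inner_tensorCoupling]
      exact Finset.aemeasurable_fun_prod _ fun i _ =>
        ((hQ i).aemeasurable (φ i) (ψ i)).comp_quasiMeasurePreserving
          (quasiMeasurePreserving_phaseEquiv i)
  have hpos : ∀ᵐ z : Phase (Fin n × κ), (tensorCoupling Q z).IsPositive := by
    filter_upwards [ae_isPositive_factors hQ] with z hz
    exact isPositive_of_sqrt (isSelfAdjoint_tensorOp_opSqrt _) (tensorOp_opSqrt_mul_self hz)
  have htrace : ∀ᵐ z : Phase (Fin n × κ),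
      posTrace (tensorCoupling Q z) = ENNReal.ofReal (tensorDensity f z) := by
    filter_upwards [ae_isPositive_factors hQ, htr, hnn] with z h1 h2 h3
    rw [tensorCoupling, posTrace_tensorOp h1, tensorDensity_eq,
      ENNReal.ofReal_prod_of_nonneg fun i _ => h3 i]
    exact Finset.prod_congr rfl fun i _ => h2 i
  refine ⟨hm, hpos, htrace,
    weakIntegral_eq_of_tensorVec (integrable_tensorDensity fun i => (hf i).integrable) hm ?_ ?_⟩
  · filter_upwards [hpos, htrace, hnn] with z h1 h2 h3
    exact norm_inner_apply_le_of_posTrace h1 (Finset.prod_nonneg fun i _ => h3 i) h2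
  · intro φ ψ
    -- On product vectors the matrix elements are products of one-particle ones, and the integral
    -- factorises by Fubini.
    simp_rw [inner_tensorCoupling]
    rw [tensorOp_tensorVec, inner_tensorVec,
      measurePreserving_phaseEquiv.integral_comp (phaseEquiv (Fin n) κ).measurableEmbedding
        (fun w : Fin n → Phase κ => ∏ i, ⟪φ i, Q i (w i) (ψ i)⟫_ℂ),
      integral_fintype_prod_volume_eq_prod fun i w => ⟪φ i, Q i w (ψ i)⟫_ℂ]
    exact Finset.prod_congr rfl fun i _ => (hQ i).integral_eq _ _

theorem lintegral_posTrace_eq_one {p : Phase κ → ℝ} (hp : IsProbabilityDensity p)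
    {A : WaveSpace κ →L[ℂ] WaveSpace κ} {P : Phase κ → (WaveSpace κ →L[ℂ] WaveSpace κ)}
    (hP : IsCoupling p A P) : ∫⁻ z, posTrace (P z) = 1 := by
  rw [lintegral_congr_ae hP.trace_eq, ← ofReal_integral_eq_lintegral_ofReal hp.integrable hp.nonneg,
    hp.integral_eq_one, ENNReal.ofReal_one]

theorem lintegral_costTrace_tensorCoupling_le [DecidableEq κ] {ħ : ℝ} (hħ : ħ ≠ 0)
    (hf : ∀ i, IsProbabilityDensity (f i)) (hQ : ∀ i, IsCoupling (f i) (R i) (Q i)) :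
    ∫⁻ z, costTrace ħ z (tensorCoupling Q z) ≤ ∑ i, ∫⁻ z, costTrace ħ z (Q i z) := by
  have hm : ∀ i j, AEMeasurable fun w : Phase κ =>
      if j = i then costTrace ħ w (Q j w) else posTrace (Q j w) := fun i j => by
    by_cases h : j = i
    · simp only [h, if_true]
      exact aemeasurable_costTrace hħ (hQ i).aemeasurable (hQ i).isPositive
    · simp only [h, if_false]
      -- The trace inherits measurability from the density, to which it is equal almost everywhere.
      exact (hf j).integrable.aemeasurable.ennreal_ofReal.congr
        ((hQ j).trace_eq.mono fun _ hz => hz.symm)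
  have hm' : ∀ i, AEMeasurable fun z : Phase (Fin n × κ) => ∏ j, if j = i
      then costTrace ħ (phaseEquiv (Fin n) κ z j) (Q j (phaseEquiv (Fin n) κ z j))
      else posTrace (Q j (phaseEquiv (Fin n) κ z j)) := fun i =>
    Finset.aemeasurable_fun_prod _ fun j _ =>
      (hm i j).comp_quasiMeasurePreserving (quasiMeasurePreserving_phaseEquiv j)
  calc ∫⁻ z, costTrace ħ z (tensorCoupling Q z)
      ≤ ∫⁻ z : Phase (Fin n × κ), ∑ i, ∏ j, if j = i
          then costTrace ħ (phaseEquiv (Fin n) κ z j) (Q j (phaseEquiv (Fin n) κ z j))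
          else posTrace (Q j (phaseEquiv (Fin n) κ z j)) := by
        refine lintegral_mono_ae ?_
        filter_upwards [ae_isPositive_factors hQ] with z hz
        exact costTrace_tensorOp_le hħ hz z
    _ = ∑ i, ∫⁻ z : Phase (Fin n × κ), ∏ j, if j = i
          then costTrace ħ (phaseEquiv (Fin n) κ z j) (Q j (phaseEquiv (Fin n) κ z j))
          else posTrace (Q j (phaseEquiv (Fin n) κ z j)) :=
        lintegral_finsetSum' _ fun i _ => hm' i
    _ = ∑ i, ∫⁻ z, costTrace ħ z (Q i z) := by
        refine Finset.sum_congr rfl fun i _ => ?_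
        rw [measurePreserving_phaseEquiv.lintegral_comp_emb
          (phaseEquiv (Fin n) κ).measurableEmbedding (fun w : Fin n → Phase κ => ∏ j, if j = i
            then costTrace ħ (w j) (Q j (w j)) else posTrace (Q j (w j))),
          lintegral_fin_prod (fun j w => if j = i then costTrace ħ w (Q j w)
            else posTrace (Q j w)) (hm i), Finset.prod_eq_single i]
        · simp
        · intro j _ hj
          simp only [hj, if_false]
          exact lintegral_posTrace_eq_one (hf j) (hQ j)
        · simp

/-! ### Passage to the infimum over couplings -/

theorem pseudoDist_sq [DecidableEq κ] (ħ : ℝ) (p : Phase κ → ℝ)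
    (A : WaveSpace κ →L[ℂ] WaveSpace κ) :
    pseudoDist ħ p A ^ 2 = ⨅ (P : Phase κ → (WaveSpace κ →L[ℂ] WaveSpace κ))
      (_ : IsCoupling p A P), ∫⁻ z, costTrace ħ z (P z) := by
  rw [pseudoDist, ← ENNReal.rpow_natCast, ← ENNReal.rpow_mul]
  simp

/-- If some infimum is `∞`, in particular if there is no admissible choice, the bound is trivial.
Otherwise near-minimisers are chosen independently in each index. -/
theorem sum_iInf_le_of_forall {ι β : Type} [Fintype ι] {C : ι → β → Prop} {J : ι → β → ℝ≥0∞}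
    {a : ℝ≥0∞} (h : ∀ Q : ι → β, (∀ i, C i (Q i)) → a ≤ ∑ i, J i (Q i)) :
    a ≤ ∑ i, ⨅ (q : β) (_ : C i q), J i q := by
  by_cases htop : ∑ i, ⨅ (q : β) (_ : C i q), J i q = ⊤
  · rw [htop]; exact le_top
  have hfin : ∀ i, ⨅ (q : β) (_ : C i q), J i q ≠ ⊤ := fun i hi =>
    htop (ENNReal.sum_eq_top.2 ⟨i, Finset.mem_univ i, hi⟩)
  refine ENNReal.le_of_forall_pos_le_add fun ε hε _ => ?_
  -- The `+ 1` keeps the denominator nonzero for empty `ι`; the total error is still at most `ε`.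
  have hδ : (ε : ℝ≥0∞) / (Fintype.card ι + 1) ≠ 0 :=
    (ENNReal.div_pos (by simpa using hε.ne') (by finiteness)).ne'
  have hex : ∀ i, ∃ q, C i q ∧
      J i q < (⨅ (q : β) (_ : C i q), J i q) + (ε : ℝ≥0∞) / (Fintype.card ι + 1) := fun i => by
    have := ENNReal.lt_add_right (hfin i) hδ
    simpa only [iInf_lt_iff, exists_prop] using this
  choose Q hC hJ using hex
  refine (h Q hC).trans ((Finset.sum_le_sum fun i _ => (hJ i).le).trans ?_)
  rw [Finset.sum_add_distrib, Finset.sum_const, Finset.card_univ, nsmul_eq_mul]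
  gcongr
  rw [← mul_div_assoc]
  refine ENNReal.div_le_of_le_mul ?_
  rw [mul_comm]
  gcongr
  exact le_self_add

end TensorCoupling

end SemiclassicalOT

end

theorem lemma7p1 (ħ : ℝ) (hħ : 0 < ħ) (d N : ℕ)
    (R : Fin N → WaveSpace (Fin d) →L[ℂ] WaveSpace (Fin d)) (hR : ∀ i, IsDensityMatrix (R i))
    (f : Fin N → Phase (Fin d) → ℝ) (hf : ∀ i, IsProbabilityDensity (f i)) :
    pseudoDist ħ (tensorDensity f) (tensorOp R) ^ 2 ≤ ∑ i, pseudoDist ħ (f i) (R i) ^ 2 := by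
  rw [pseudoDist_sq]
  simp_rw [pseudoDist_sq]
  refine sum_iInf_le_of_forall fun Q hQ => ?_
  exact (iInf₂_le (tensorCoupling Q) (isCoupling_tensorCoupling hf hQ)).trans
    (lintegral_costTrace_tensorCoupling_le hħ.ne' hf hQ)
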